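/- **Setting.** Let $X\subset\mathbb R^n$ be compact, any two of its points being joined by a path of finite length in $X$, and let $d(p,q)$ be the length of a shortest path in $X$ from $p$ to $q$. Let $\varphi:X\to[0,\infty)$ be measurable with $\int_X\varphi=1$, and let $f:[0,\infty)\to[0,\infty)$ be strictly increasing and subadditive. For $m\ge1$ robots at $Q=(q_1,\dots,q_m)\in X^m$ put $$\mathcal H(Q)=\int_X\min_i f(d(p,q_i))\,\varphi(p)\,dp .$$ Let $S\subset X$ be a finite set of samples with dispersion $\zeta=\sup_{p\in X}\min_{u\in S}d(p,u)<\infty$. For $p\in X$ let $\sigma^{-1}(p)\in S$ be a closest sample (ties are broken by any rule for which the cells $\{p\in X:\sigma^{-1}(p)=v\}$ are measurable). For $u,v\in S$ put $c(u,v)=f(d(u,v))$ and $w(v)=\int_{\{p\in X:\,\sigma^{-1}(p)=v\}}\varphi(p)\,dp$. For $Q\in S^m$ let $W_i$ be the set of samples $u$ with $c(u,q_i)\le c(u,q_j)$ for all $j$, ties being won by the smaller index, let $V_i=\{p\in X: d(p,q_i)\le d(p,q_j)\ \forall j\}$ and $r_i=\sup_{p\in V_i}d(p,q_i)$. The neighbours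 of robot $i$ are $N(i)=\{j: d(q_i,q_j)\le4\max(r_i,r_j)\}$, which contains $i$; put $O_i=\{q_j: j\in N(i),\ j\ne i\}$. **Algorithm** (threshold $\epsilon_0>0$, any initial configuration $Q_0\in S^m$). All robots start active. While some robot is active, an arbitrary active robot $i$ takes a turn: if $\sum_{u\in W_i}c(u,q_i)>0$, it performs local moves as long as one is available; then it becomes inactive. If the configuration was changed during the turn, all other robots become active (again). The algorithm stops, and returns the current configuration, when all robots are inactive. A local move of robot $i$ is one of the following. 1. For $v\in W_i$ let $\delta_v=\sum_{j\in N(i)}\sum_{u\in W_j}w(u)\big[\min_{x\in O_i\cup\{v\}}c(u,x)-c(u,q_j)\big]$. If $\min_{v\in W_i}\delta_v\le-\epsilon_0$, robot $i$ moves to a minimizer $v$. 2. Otherwise, for $v\in W_i$ let $\rho_v=\sum_{j\in N(i)}\sum_{u\in R_j(v)}w(u)[c(u,v)-c(u,q_j)]$ with $R_j(v)=\{u\in W_j:c(u,v)<c(u,q_j)\}$. Robot $i$ sends $(\rho_v)_{v\in W_i}$ with counter $1$ to its neighbours. Each other robot $k$ treats only the message with the smallest counter that it receives, and a neighbour that sent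 it is its parent. If the counter is $1$, robot $k$ computes $\ell_v=\sum_{u\in W_k\setminus R_k(v)}w(u)\big[\min_{x\in O_k\cup\{v\}}c(u,x)-c(u,q_k)\big]$; if the counter is larger, it computes $\ell_v=\ell=\sum_{u\in W_k}w(u)\big[\min_{x\in O_k}c(u,x)-c(u,q_k)\big]$. If $\rho_v+\ell_v\le-\epsilon_0$ for some $v\in W_i$, it accepts; otherwise it forwards the message to its neighbours with the counter increased by one. If some robot accepts, a pair (accepting robot $k$, vertex $v$) with the least $\rho_v+\ell_v$ is selected; then robot $i$ moves to $v$, and each other robot on the chain of parents from $k$ to $i$ moves to the previous position of its parent. **Statement.** From every initial configuration the algorithm returns some configuration, and every configuration $Q$ that it can return satisfies, for every minimizer $S^*$ of $\mathcal H$ over $X^m$, $$\mathcal H(Q)\le 5\,\mathcal H(S^*)+21\,f(\zeta)+m\,\epsilon_0 .$$ In particular $\mathcal H(Q)\le5\,\mathcal H(S^*)+O(f(\zeta)+\epsilon_0)$, with a constant that depends only on $m$. -/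

import Mathlib

open scoped ENNReal NNReal

noncomputable section

namespace Coverage

/-- Points of the ambient Euclidean space `ℝⁿ`. -/
abbrev Loc (n : ℕ) := EuclideanSpace ℝ (Fin n)

/-- Infimum of the lengths of the continuous paths inside `X` from `p` to `q` (the length of a path
is its total variation); it is `∞` if there is no path of finite length. -/
def pathEDist {n : ℕ} (X : Set (Loc n)) (p q : Loc n) : ℝ≥0∞ :=
  ⨅ (γ : ℝ → Loc n) (_ : ContinuousOn γ (Set.Icc 0 1) ∧ Set.MapsTo γ (Set.Icc 0 1) X ∧
    γ 0 = p ∧ γ 1 = q), eVariationOn γ (Set.Icc 0 1)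

/-- A continuous coverage problem in `ℝⁿ`. -/
structure Problem (n : ℕ) where
  /-- the obstacle-free part of the environment -/
  X : Set (Loc n)
  isCompact_X : IsCompact X
  /-- any two locations are joined inside `X` by a path of finite length -/
  connected : ∀ p ∈ X, ∀ q ∈ X, pathEDist X p q ≠ ∞
  /-- the density of the event distribution -/
  φ : Loc n → ℝ≥0
  aemeasurable_φ : AEMeasurable φ (MeasureTheory.volume.restrict X)
  mass_one : ∫⁻ p in X, (φ p : ℝ≥0∞) = 1
  /-- the sensing function -/
  f : ℝ≥0 → ℝ≥0
  strictMono_f : StrictMono f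
  subadditive_f : ∀ x y, f (x + y) ≤ f x + f y

namespace Problem

variable {n : ℕ} (P : Problem n) {m : ℕ}

/-- The length of a shortest path in the environment between two locations. -/
def dist (p q : Loc n) : ℝ≥0 := (pathEDist P.X p q).toNNReal

/-- The continuous coverage cost `ℋ(Q) = ∫_X min_i f (d (p, q_i)) φ(p) dp`. -/
def cost (Q : Fin m → Loc n) : ℝ≥0∞ :=
  ∫⁻ p in P.X, (⨅ i, (P.f (P.dist p (Q i)) : ℝ≥0∞)) * (P.φ p : ℝ≥0∞)

/-- `Q` minimizes the coverage cost among all configurations of `m` robots in the environment. -/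
def IsOptimal (Q : Fin m → Loc n) : Prop :=
  (∀ i, Q i ∈ P.X) ∧ ∀ Q' : Fin m → Loc n, (∀ i, Q' i ∈ P.X) → P.cost Q ≤ P.cost Q'

/-- The Voronoi cell of robot `i` in the continuous environment. -/
def voronoi (Q : Fin m → Loc n) (i : Fin m) : Set (Loc n) :=
  {p | p ∈ P.X ∧ ∀ j, P.dist p (Q i) ≤ P.dist p (Q j)}

/-- The largest distance of robot `i` from a point of its Voronoi cell. -/
def radius (Q : Fin m → Loc n) (i : Fin m) : ℝ≥0 :=
  sSup ((fun p => P.dist p (Q i)) '' P.voronoi Q i)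

/-- The neighbours of robot `i`; robot `i` is one of them. -/
def neighbors (Q : Fin m → Loc n) (i : Fin m) : Finset (Fin m) :=
  {j | P.dist (Q i) (Q j) ≤ 4 * max (P.radius Q i) (P.radius Q j)}

/-- A finite set of sampled locations, with a choice `near p` of a closest sample for every location
`p`. Ties are broken by `near`, so that the cells of the samples form a partition of the
environment. -/
structure Sampling where
  S : Finset (Loc n)
  subset_X : ∀ v ∈ S, v ∈ P.X
  near : Loc n → {v // v ∈ S}
  dist_near_le : ∀ p ∈ P.X, ∀ u ∈ S, P.dist p (near p) ≤ P.dist p u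
  measurableSet_cell : ∀ v, MeasurableSet {p | p ∈ P.X ∧ near p = v}

end Problem

namespace Problem.Sampling

variable {n : ℕ} {P : Problem n} (𝒮 : P.Sampling) {m : ℕ}

/-- The vertices of the graph, that is, the sampled locations. -/
abbrev V : Type := {v : Loc n // v ∈ 𝒮.S}

/-- A configuration of `m` robots on the vertices. The identifier of a robot is its index. -/
abbrev Config (m : ℕ) : Type := Fin m → 𝒮.V

/-- `ζ` is the dispersion of the sampling: the supremum over all locations of the distance to the
closest sample. -/
def IsDispersion (ζ : ℝ≥0) : Prop :=
  IsLUB ((fun p : Loc n => ⨅ u : 𝒮.V, P.dist p u) '' P.X) ζ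

/-- The edge cost. -/
def c (u v : 𝒮.V) : ℝ := P.f (P.dist u v)

/-- The weight of a vertex: the mass of the set of locations whose chosen closest sample it is. -/
def w (v : 𝒮.V) : ℝ := (∫⁻ p in {p | p ∈ P.X ∧ 𝒮.near p = v}, (P.φ p : ℝ≥0∞)).toReal

/-- The locations of the robots of a configuration. -/
def loc (q : 𝒮.Config m) : Fin m → Loc n := fun i => q i

/-- The partition of robot `i`: the vertices closer to it than to any other robot, where ties are
won by the robot with the smaller identifier. -/
def part (q : 𝒮.Config m) (i : Fin m) : Finset 𝒮.V :=
  open Classical in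
  {u | ∀ j, j ≠ i → 𝒮.c u (q i) < 𝒮.c u (q j) ∨ (𝒮.c u (q i) = 𝒮.c u (q j) ∧ i < j)}

/-- The neighbours of robot `i` (with `i` among them). -/
def nbr (q : 𝒮.Config m) (i : Fin m) : Finset (Fin m) := P.neighbors (𝒮.loc q) i

/-- The positions of the neighbours of robot `i` other than `i`. -/
def others (q : 𝒮.Config m) (i : Fin m) : Set 𝒮.V := {x | ∃ j ∈ 𝒮.nbr q i, j ≠ i ∧ x = q j}

/-- The least cost from `u` to an element of the set `T`. -/
def minCost (u : 𝒮.V) (T : Set 𝒮.V) : ℝ := sInf ((fun x => 𝒮.c u x) '' T)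

/-- The change `δ_v` of the local objective if robot `i` moves to `v`. -/
def delta (q : 𝒮.Config m) (i : Fin m) (v : 𝒮.V) : ℝ :=
  ∑ j ∈ 𝒮.nbr q i, ∑ u ∈ 𝒮.part q j,
    𝒮.w u * (𝒮.minCost u (insert v (𝒮.others q i)) - 𝒮.c u (q j))

/-- The vertices `R_j(v)` in the partition of robot `j` that are closer to `v` than to robot `j`. -/
def gained (q : 𝒮.Config m) (j : Fin m) (v : 𝒮.V) : Finset 𝒮.V :=
  open Classical in {u ∈ 𝒮.part q j | 𝒮.c u v < 𝒮.c u (q j)}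

/-- The change `ρ_v` of the local objective if robot `i` moves to `v` and a new robot appears at the
old position of `i`. -/
def rho (q : 𝒮.Config m) (i : Fin m) (v : 𝒮.V) : ℝ :=
  ∑ j ∈ 𝒮.nbr q i, ∑ u ∈ 𝒮.gained q j v, 𝒮.w u * (𝒮.c u v - 𝒮.c u (q j))

/-- The change `ℓ_v` computed by a robot `k` that receives the message with counter one. -/
def ellNear (q : 𝒮.Config m) (k : Fin m) (v : 𝒮.V) : ℝ :=
  open Classical in
  ∑ u ∈ 𝒮.part q k \ 𝒮.gained q k v,
    𝒮.w u * (𝒮.minCost u (insert v (𝒮.others q k)) - 𝒮.c u (q k))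

/-- The change `ℓ` computed by a robot `k` that receives the message with a counter above one. -/
def ellFar (q : 𝒮.Config m) (k : Fin m) : ℝ :=
  ∑ u ∈ 𝒮.part q k, 𝒮.w u * (𝒮.minCost u (𝒮.others q k) - 𝒮.c u (q k))

/-- The total change that robot `k` associates with the vertex `v` offered by robot `i`, when the
message reaches it with counter `h`. -/
def value (q : 𝒮.Config m) (i : Fin m) (h : ℕ) (k : Fin m) (v : 𝒮.V) : ℝ :=
  𝒮.rho q i v + if h = 1 then 𝒮.ellNear q k v else 𝒮.ellFar q k

/-- Robot `k`, reached by the message of robot `i` with counter `h`, accepts. -/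
def Accepts (ε₀ : ℝ≥0) (q : 𝒮.Config m) (i : Fin m) (h : ℕ) (k : Fin m) : Prop :=
  ∃ v ∈ 𝒮.part q i, 𝒮.value q i h k v ≤ -ε₀

/-- Robot `k`, reached with counter `h`, sends the message to its neighbours with counter `h + 1`:
this is done by the originator (`h = 0`) and by every robot that does not accept. -/
def Forwards (ε₀ : ℝ≥0) (q : 𝒮.Config m) (i : Fin m) (h : ℕ) (k : Fin m) : Prop :=
  h = 0 ∨ ¬ 𝒮.Accepts ε₀ q i h k

/-- The propagation of the message of robot `i`. The first component for `h` is the set of robots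
for which the smallest counter of a received message is `h` (the originator for `h = 0`), the second
component is the set of robots reached with a counter at most `h`. -/
def flood (ε₀ : ℝ≥0) (q : 𝒮.Config m) (i : Fin m) : ℕ → Finset (Fin m) × Finset (Fin m)
  | 0 => ({i}, {i})
  | h + 1 =>
    open Classical in
    let s := flood ε₀ q i h
    let new : Finset (Fin m) :=
      {k | k ∉ s.2 ∧ ∃ p ∈ s.1, 𝒮.Forwards ε₀ q i h p ∧ k ∈ 𝒮.nbr q p}
    (new, s.2 ∪ new)

/-- Robot `k` is reached by the message of robot `i`, with smallest counter `h`. -/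
def Reached (ε₀ : ℝ≥0) (q : 𝒮.Config m) (i : Fin m) (h : ℕ) (k : Fin m) : Prop :=
  k ∈ (𝒮.flood ε₀ q i h).1

/-- One iteration of the local move procedure of robot `i` that changes the configuration `q` to
`q'`. -/
inductive LocalMove (ε₀ : ℝ≥0) (i : Fin m) (q q' : 𝒮.Config m) : Prop
  /-- Robot `i` moves inside its partition to a vertex with the least change. -/
  | single (v : 𝒮.V) (hv : v ∈ 𝒮.part q i)
      (improves : 𝒮.delta q i v ≤ -ε₀)
      (best : ∀ v' ∈ 𝒮.part q i, 𝒮.delta q i v ≤ 𝒮.delta q i v')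
      (move : q' = Function.update q i v)
  /-- There is no move of the first kind. The message of robot `i` has travelled along
  `i = r 0, r 1, …, r h`, where `r t` is the parent of `r (t + 1)`, and `r h` has accepted; its
  answer is the best of all answers. Robot `i` moves to `v`, and each other robot of the chain moves
  to the position of its parent. -/
  | chain (noSingle : ∀ v' ∈ 𝒮.part q i, ¬ 𝒮.delta q i v' ≤ -ε₀)
      (h : ℕ) (hpos : 1 ≤ h) (r : ℕ → Fin m)
      (start : r 0 = i)
      (reached : ∀ t ≤ h, 𝒮.Reached ε₀ q i t (r t))
      (parent : ∀ t < h, 𝒮.Forwards ε₀ q i t (r t) ∧ r (t + 1) ∈ 𝒮.nbr q (r t))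
      (v : 𝒮.V) (hv : v ∈ 𝒮.part q i)
      (improves : 𝒮.value q i h (r h) v ≤ -ε₀)
      (best : ∀ h' k', 1 ≤ h' → 𝒮.Reached ε₀ q i h' k' → ∀ v' ∈ 𝒮.part q i,
        𝒮.value q i h (r h) v ≤ 𝒮.value q i h' k' v')
      (move_start : q' i = v)
      (move_chain : ∀ t < h, q' (r (t + 1)) = q (r t))
      (stay : ∀ j, (∀ t ≤ h, j ≠ r t) → q' j = q j)

/-- A state of the algorithm: the configuration and the set of active robots. -/
abbrev State (m : ℕ) : Type := 𝒮.Config m × Finset (Fin m)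

/-- The turn of an active robot `i`. If `∑_{u ∈ W_i} c (u, q_i)` is positive, robot `i` performs local
moves as long as there is one. It then becomes inactive. If the configuration has been changed during
the turn, then all other robots are active afterwards, since new moves may be available to them. -/
inductive Turn (ε₀ : ℝ≥0) : 𝒮.State m → 𝒮.State m → Prop
  | skip (q : 𝒮.Config m) (A : Finset (Fin m)) (i : Fin m) (hi : i ∈ A)
      (guard : ¬ 0 < ∑ u ∈ 𝒮.part q i, 𝒮.c u (q i)) :
      Turn ε₀ (q, A) (q, A.erase i)
  | noMove (q : 𝒮.Config m) (A : Finset (Fin m)) (i : Fin m) (hi : i ∈ A)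
      (guard : 0 < ∑ u ∈ 𝒮.part q i, 𝒮.c u (q i))
      (done : ∀ q', ¬ 𝒮.LocalMove ε₀ i q q') :
      Turn ε₀ (q, A) (q, A.erase i)
  | moves (q q' : 𝒮.Config m) (A : Finset (Fin m)) (i : Fin m) (hi : i ∈ A)
      (guard : 0 < ∑ u ∈ 𝒮.part q i, 𝒮.c u (q i))
      (run : Relation.TransGen (𝒮.LocalMove ε₀ i) q q')
      (done : ∀ q'', ¬ 𝒮.LocalMove ε₀ i q' q'') :
      Turn ε₀ (q, A) (q', Finset.univ.erase i)

/-- Some execution of the distributed coverage algorithm with improvement threshold `ε₀`, started in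
`q₀` with all robots active, ends in `q` with all robots inactive. -/
def Returns (ε₀ : ℝ≥0) (q₀ q : 𝒮.Config m) : Prop :=
  Relation.ReflTransGen (𝒮.Turn ε₀) (q₀, Finset.univ) (q, ∅)

end Problem.Sampling

end Coverage

end

/-! ### Path length as a metric -/

namespace Coverage

open Set Filter Topology

section PathMetric

variable {n : ℕ} {X : Set (Loc n)}

/-! Let `total` be the cost of a configuration on the weighted graph of samples. The algorithm is a
single-swap local search for this m-median cost, and the locality of its computations loses nothing.

The numbers computed by the robots are true changes of `total` (`delta_eq`, `value_eq`), for two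
geometric reasons. A vertex that prefers a vertex of `W_i` to its own robot is served by a neighbour
of `i` (`mem_neighbors_of_closer`). A vertex that loses its robot `k` finds a good substitute among
the neighbours of `k`, because a nearly shortest path that leaves the cell of `k` enters the cell of
a neighbour (`exists_neighbor_closer`). Shifting the robots of a chain changes the set of positions
as if only the last one had moved (`range_chain`). So every local move lowers `total` by at least
`ε₀`, and there are finitely many configurations. The neighbour graph is connected, so a message
that nobody accepts reaches everyone; hence in a returned configuration no relocation of one robot
to any vertex gains more than `ε₀` (`total_update_ge_of_returns`).

Such a configuration is within a factor five of every other one, up to `m ε₀` (`total_le_five_mul`):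
one adds up `m` swaps, each bringing in one robot of the competitor, with no robot swapped out more
than twice. Rounding a continuous optimum to the samples costs `2 f(ζ)`, and returning to the
continuous cost adds `f(ζ)`. The total error is `(5 · 2 + 1) f(ζ) + m ε₀`. -/

theorem pathEDist_self {p : Loc n} (hp : p ∈ X) : pathEDist X p p = 0 := by
  refine le_antisymm ?_ bot_le
  refine (iInf₂_le (fun _ => p) ⟨continuousOn_const, fun _ _ => hp, rfl, rfl⟩).trans ?_
  exact (eVariationOn.constant_on (by
    rintro _ ⟨_, _, rfl⟩ _ ⟨_, _, rfl⟩; rfl)).le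

theorem pathEDist_comm_le (p q : Loc n) : pathEDist X p q ≤ pathEDist X q p := by
  refine le_iInf₂ fun γ hγ => ?_
  obtain ⟨hc, hm, h0, h1⟩ := hγ
  have hmaps : MapsTo (fun t : ℝ => 1 - t) (Icc 0 1) (Icc 0 1) := by
    intro t ht; simp only [mem_Icc] at ht ⊢; constructor <;> linarith [ht.1, ht.2]
  refine (iInf₂_le (γ ∘ fun t => 1 - t) ⟨hc.comp (by fun_prop) hmaps, hm.comp hmaps,
    by simp [h1], by simp [h0]⟩).trans ?_
  exact eVariationOn.comp_le_of_antitoneOn γ _ (fun a _ b _ hab => sub_le_sub_left hab 1) hmaps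

theorem pathEDist_comm (p q : Loc n) : pathEDist X p q = pathEDist X q p :=
  le_antisymm (pathEDist_comm_le p q) (pathEDist_comm_le q p)

/-- A subarc bounds the path distance of its end points. -/
theorem pathEDist_le_eVariationOn {γ : ℝ → Loc n} {a b : ℝ} (hab : a ≤ b)
    (hc : ContinuousOn γ (Icc a b)) (hm : MapsTo γ (Icc a b) X) :
    pathEDist X (γ a) (γ b) ≤ eVariationOn γ (Icc a b) := by
  have hmaps : MapsTo (fun t : ℝ => a + t * (b - a)) (Icc 0 1) (Icc a b) := by
    intro t ht
    simp only [mem_Icc] at ht ⊢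
    constructor <;> nlinarith [ht.1, ht.2]
  refine (iInf₂_le (γ ∘ fun t => a + t * (b - a)) ⟨hc.comp (by fun_prop) hmaps, hm.comp hmaps,
    by simp, by simp⟩).trans ?_
  refine eVariationOn.comp_le_of_monotoneOn γ _ (fun s _ t _ hst => ?_) hmaps
  have : s * (b - a) ≤ t * (b - a) := mul_le_mul_of_nonneg_right hst (by linarith)
  simpa using this

/-- Concatenate two paths on `[0, 2]`; variation is additive at the junction, and
`pathEDist_le_eVariationOn` takes care of the rescaling to `[0, 1]`. -/
theorem pathEDist_triangle (p q r : Loc n) :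
    pathEDist X p r ≤ pathEDist X p q + pathEDist X q r := by
  conv_rhs => simp only [pathEDist, ENNReal.iInf_add, ENNReal.add_iInf]
  refine le_iInf₂ fun γ₂ h₂ => le_iInf₂ fun γ₁ h₁ => ?_
  obtain ⟨hc₁, hm₁, h₁0, h₁1⟩ := h₁
  obtain ⟨hc₂, hm₂, h₂0, h₂1⟩ := h₂
  set γ : ℝ → Loc n := fun t => if t ≤ 1 then γ₁ t else γ₂ (t - 1) with hγ
  have e₁ : EqOn γ γ₁ (Icc 0 1) := fun t ht => by simp [hγ, ht.2]
  have e₂ : EqOn γ (γ₂ ∘ fun t => t - 1) (Icc 1 2) := fun t ht => by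
    rcases ht.1.eq_or_lt with rfl | h
    · simp [hγ, h₁1, h₂0]
    · simp [hγ, not_le.2 h]
  have hmaps : MapsTo (fun t : ℝ => t - 1) (Icc 1 2) (Icc 0 1) := fun t ht =>
    ⟨by linarith [ht.1], by linarith [ht.2]⟩
  have hU : Icc (0 : ℝ) 2 = Icc 0 1 ∪ Icc 1 2 :=
    (Icc_union_Icc_eq_Icc (by norm_num) (by norm_num)).symm
  have hc : ContinuousOn γ (Icc 0 2) := by
    rw [hU]
    exact (hc₁.congr e₁).union_of_isClosed ((hc₂.comp (by fun_prop) hmaps).congr e₂)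
      isClosed_Icc isClosed_Icc
  have hm : MapsTo γ (Icc 0 2) X := by
    rw [hU]
    rintro t (ht | ht)
    · rw [e₁ ht]; exact hm₁ ht
    · rw [e₂ ht]; exact hm₂ (hmaps ht)
  have hle := pathEDist_le_eVariationOn (show (0 : ℝ) ≤ 2 by norm_num) hc hm
  rw [show γ 0 = p by simp [hγ, h₁0], show γ 2 = r by norm_num [hγ, h₂1], hU,
    eVariationOn.union γ (isGreatest_Icc zero_le_one) (isLeast_Icc one_le_two),
    eVariationOn.congr e₁, eVariationOn.congr e₂] at hle
  refine hle.trans (add_le_add le_rfl ?_)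
  exact eVariationOn.comp_le_of_monotoneOn γ₂ _ (fun a _ b _ hab => sub_le_sub_right hab 1) hmaps

/-- A path from a set to its complement has a short jump out of the set. -/
theorem exists_crossing {γ : ℝ → Loc n} (hc : ContinuousOn γ (Icc 0 1))
    (hfin : eVariationOn γ (Icc 0 1) ≠ ∞) {U : Set (Loc n)} (h0 : γ 0 ∈ U) (h1 : γ 1 ∉ U)
    {ε : ℝ≥0∞} (hε : 0 < ε) :
    ∃ s t, 0 ≤ s ∧ s ≤ t ∧ t ≤ 1 ∧ eVariationOn γ (Icc s t) ≤ ε ∧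
      γ s ∈ U ∧ γ t ∉ U := by
  set T : Set ℝ := {t | t ∈ Icc (0 : ℝ) 1 ∧ γ t ∈ U}
  have hne : T.Nonempty := ⟨0, by simp, h0⟩
  have hbd : BddAbove T := ⟨1, fun t ht => ht.1.2⟩
  -- The set `U` is arbitrary, so the last time in `U` need not be attained. If it is, the jump
  -- starts at `x` and goes right; otherwise it ends at `x` and starts slightly to the left. Both
  -- are short because the variation of a continuous path over shrinking intervals tends to zero.
  set x := sSup T
  have hx0 : 0 ≤ x := le_csSup hbd ⟨by simp, h0⟩
  have hx1 : x ≤ 1 := csSup_le hne fun t ht => ht.1.2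
  have hx : x ∈ Icc (0 : ℝ) 1 := ⟨hx0, hx1⟩
  have hbv : BoundedVariationOn γ (Icc 0 1) := hfin
  by_cases hxU : γ x ∈ U
  · have hlt : x < 1 := lt_of_le_of_ne hx1 fun h => h1 (h ▸ hxU)
    have ht := hbv.tendsto_eVariationOn_Icc_zero_right x ((hc x hx).mono inter_subset_left)
    have hev := ht.eventually (gt_mem_nhds hε)
    have hev' := nhdsWithin_mono x
      (show Ioc x 1 ⊆ Icc 0 1 from fun t ht => ⟨hx0.trans ht.1.le, ht.2⟩) hev
    have : (𝓝[Ioc x 1] x).NeBot := by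
      rw [nhdsWithin_Ioc_eq_nhdsGT hlt]; infer_instance
    obtain ⟨t, hts, htI⟩ := (Filter.Eventually.and hev' self_mem_nhdsWithin).exists
    refine ⟨x, t, hx0, htI.1.le, htI.2, ?_, hxU, fun htU => ?_⟩
    · rw [inter_eq_self_of_subset_right (Icc_subset_Icc hx0 htI.2)] at hts
      exact hts.le
    · exact absurd (le_csSup hbd ⟨⟨hx0.trans htI.1.le, htI.2⟩, htU⟩) (not_le.2 htI.1)
  · have ht := hbv.tendsto_eVariationOn_Icc_zero_left ((hc x hx).mono inter_subset_left)
    have hev := ht.eventually (gt_mem_nhds hε)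
    obtain ⟨δ, hδ, hball⟩ := Metric.mem_nhdsWithin_iff.1 hev
    obtain ⟨s, hsT, hs⟩ := exists_lt_of_lt_csSup hne (show x - δ < sSup T by linarith)
    have hsx : s ≤ x := le_csSup hbd hsT
    refine ⟨s, x, hsT.1.1, hsx, hx1, ?_, hsT.2, hxU⟩
    have := hball ⟨by rw [Metric.mem_ball, Real.dist_eq, abs_lt]; constructor <;> linarith, hsT.1⟩
    simp only [mem_ofPred_eq] at this
    rw [inter_eq_self_of_subset_right (Icc_subset_Icc hsT.1.1 hx1)] at this
    exact this.le

end PathMetric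

namespace Problem

variable {n : ℕ} (P : Problem n)

theorem coe_dist {p q : Loc n} (hp : p ∈ P.X) (hq : q ∈ P.X) :
    (P.dist p q : ℝ≥0∞) = pathEDist P.X p q :=
  ENNReal.coe_toNNReal (P.connected p hp q hq)

theorem dist_self {p : Loc n} (hp : p ∈ P.X) : P.dist p p = 0 := by
  simp [dist, pathEDist_self hp]

theorem dist_comm (p q : Loc n) : P.dist p q = P.dist q p := by
  rw [dist, dist, pathEDist_comm]

theorem dist_triangle {p q r : Loc n} (hp : p ∈ P.X) (hq : q ∈ P.X) (hr : r ∈ P.X) :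
    P.dist p r ≤ P.dist p q + P.dist q r := by
  rw [← ENNReal.coe_le_coe, ENNReal.coe_add, P.coe_dist hp hr, P.coe_dist hp hq, P.coe_dist hq hr]
  exact pathEDist_triangle p q r

/-- On an almost shortest path from a set to its complement there is a short step out of the
set. -/
theorem exists_step_out {p q : Loc n} (hp : p ∈ P.X) (hq : q ∈ P.X) {U : Set (Loc n)}
    (hpU : p ∈ U) (hqU : q ∉ U) {ε : ℝ≥0} (hε : 0 < ε) :
    ∃ a b, a ∈ P.X ∧ b ∈ P.X ∧ a ∈ U ∧ b ∉ U ∧ P.dist a b ≤ ε ∧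
      P.dist p a + P.dist b q ≤ P.dist p q + ε := by
  have hlt : pathEDist P.X p q < P.dist p q + ε := by
    rw [P.coe_dist hp hq]
    exact ENNReal.lt_add_right (P.connected p hp q hq) (by simpa using hε.ne')
  obtain ⟨γ, hγ⟩ := iInf_lt_iff.1 hlt
  obtain ⟨⟨hc, hm, rfl, rfl⟩, hlen⟩ := iInf_lt_iff.1 hγ
  obtain ⟨s, t, hs, hst, ht, hvar, hsU, htU⟩ := exists_crossing hc
    (hlen.trans (by simp [lt_top_iff_ne_top])).ne hpU hqU (show (0 : ℝ≥0∞) < ε by simpa using hε)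
  have hs1 : s ∈ Icc (0 : ℝ) 1 := ⟨hs, hst.trans ht⟩
  have ht1 : t ∈ Icc (0 : ℝ) 1 := ⟨hs.trans hst, ht⟩
  have sub : ∀ a b, 0 ≤ a → a ≤ b → b ≤ 1 →
      pathEDist P.X (γ a) (γ b) ≤ eVariationOn γ (Icc a b) := fun a b ha hab hb =>
    pathEDist_le_eVariationOn hab (hc.mono (Icc_subset_Icc ha hb))
      (hm.mono_left (Icc_subset_Icc ha hb))
  refine ⟨γ s, γ t, hm hs1, hm ht1, hsU, htU, ?_, ?_⟩
  · rw [← ENNReal.coe_le_coe, P.coe_dist (hm hs1) (hm ht1)]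
    exact (sub s t hs hst ht).trans hvar
  · rw [← ENNReal.coe_le_coe, ENNReal.coe_add, ENNReal.coe_add, P.coe_dist hp (hm hs1),
      P.coe_dist (hm ht1) hq]
    -- The subarcs on `[0, s]` and `[t, 1]` do not overlap, so their lengths add up to at most the
    -- length of the path.
    refine le_trans ?_ hlen.le
    refine (add_le_add (sub 0 s le_rfl hs hs1.2) (sub t 1 ht1.1 ht le_rfl)).trans ?_
    refine (eVariationOn.add_le_union γ fun x hx y hy => hx.2.trans (hst.trans hy.1)).trans ?_
    exact eVariationOn.mono γ (union_subset (Icc_subset_Icc le_rfl hs1.2)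
      (Icc_subset_Icc ht1.1 le_rfl))

end Problem

end Coverage

/-! ### Geometry of Voronoi cells and neighbours -/

namespace Coverage

open Set Filter Topology

/-- Removes the errors of almost shortest paths: finitely many comparisons of fixed numbers share
one `ε` below all their gaps, so no shortest path has to exist. -/
theorem eventually_le_of_le_add (x y : ℝ) : ∀ᶠ ε in 𝓝[>] (0 : ℝ), x ≤ y + 2 * ε → x ≤ y := by
  rcases le_or_gt x y with h | h
  · exact Eventually.of_forall fun _ _ => h
  · filter_upwards [Ioo_mem_nhdsGT (show (0 : ℝ) < (x - y) / 2 by linarith)] with ε hε hle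
    linarith [hε.2]

namespace Problem

variable {n m : ℕ} (P : Problem n) {Q : Fin m → Loc n} {B : ℝ≥0}

theorem real_dist_triangle {p q r : Loc n} (hp : p ∈ P.X) (hq : q ∈ P.X) (hr : r ∈ P.X) :
    (P.dist p r : ℝ) ≤ P.dist p q + P.dist q r := by
  exact_mod_cast P.dist_triangle hp hq hr

theorem mem_neighbors_iff {i j : Fin m} : j ∈ P.neighbors Q i ↔
    (P.dist (Q i) (Q j) : ℝ) ≤ 4 * max (P.radius Q i : ℝ) (P.radius Q j) := by
  simp only [neighbors, Finset.mem_filter, Finset.mem_univ, true_and]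
  exact_mod_cast Iff.rfl

theorem mem_neighbors_comm {i j : Fin m} : j ∈ P.neighbors Q i ↔ i ∈ P.neighbors Q j := by
  rw [mem_neighbors_iff, mem_neighbors_iff, max_comm, P.dist_comm]

/-- The geometric arguments below produce the constant 3; the 4 in the definition leaves slack. -/
theorem mem_neighbors_of_le {i j : Fin m}
    (h : (P.dist (Q i) (Q j) : ℝ) ≤ 3 * max (P.radius Q i : ℝ) (P.radius Q j)) :
    j ∈ P.neighbors Q i := by
  rw [mem_neighbors_iff]
  have : (0 : ℝ) ≤ max (P.radius Q i : ℝ) (P.radius Q j) := le_max_of_le_left (NNReal.coe_nonneg _)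
  linarith

theorem dist_le_radius (hQ : ∀ i, Q i ∈ P.X) (hB : ∀ p ∈ P.X, ∀ q ∈ P.X, P.dist p q ≤ B)
    {i : Fin m} {p : Loc n} (hp : p ∈ P.voronoi Q i) :
    (P.dist p (Q i) : ℝ) ≤ P.radius Q i := by
  refine NNReal.coe_le_coe.2 (le_csSup ⟨B, ?_⟩ ⟨p, hp, rfl⟩)
  rintro _ ⟨x, hx, rfl⟩
  exact hB x hx.1 _ (hQ i)

theorem exists_mem_voronoi (hm : 0 < m) (Q : Fin m → Loc n) {p : Loc n} (hp : p ∈ P.X) :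
    ∃ i, p ∈ P.voronoi Q i := by
  have : Nonempty (Fin m) := ⟨⟨0, hm⟩⟩
  obtain ⟨i, hi⟩ := Finite.exists_min fun i => P.dist p (Q i)
  exact ⟨i, hp, hi⟩

theorem self_mem_voronoi (hQ : ∀ i, Q i ∈ P.X) (i : Fin m) : Q i ∈ P.voronoi Q i :=
  ⟨hQ i, fun j => by rw [P.dist_self (hQ i)]; exact zero_le⟩

/-- Robots whose Voronoi cells have a common point are neighbours. -/
theorem mem_neighbors_of_mem_voronoi (hQ : ∀ i, Q i ∈ P.X)
    (hB : ∀ p ∈ P.X, ∀ q ∈ P.X, P.dist p q ≤ B) {i j : Fin m} {p : Loc n}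
    (hi : p ∈ P.voronoi Q i) (hj : p ∈ P.voronoi Q j) : j ∈ P.neighbors Q i := by
  apply P.mem_neighbors_of_le
  have h1 := P.dist_le_radius hQ hB hi
  have h2 := P.dist_le_radius hQ hB hj
  have h3 := P.real_dist_triangle (hQ i) hi.1 (hQ j)
  rw [P.dist_comm (Q i) p] at h3
  have := le_max_left (P.radius Q i : ℝ) (P.radius Q j)
  have := le_max_right (P.radius Q i : ℝ) (P.radius Q j)
  linarith [NNReal.coe_nonneg (P.radius Q i)]

/-- A robot `i` whose cell contains `v` is a neighbour of a robot `j` that serves a point which is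
closer to `v`. -/
theorem mem_neighbors_of_closer (hQ : ∀ i, Q i ∈ P.X)
    (hB : ∀ p ∈ P.X, ∀ q ∈ P.X, P.dist p q ≤ B) {i j : Fin m} {u v : Loc n}
    (hv : v ∈ P.voronoi Q i) (hu : u ∈ P.voronoi Q j) (h : P.dist u v ≤ P.dist u (Q j)) :
    j ∈ P.neighbors Q i := by
  apply P.mem_neighbors_of_le
  have h1 := P.dist_le_radius hQ hB hv
  have h2 := P.dist_le_radius hQ hB hu
  have h3 := P.real_dist_triangle (hQ i) hv.1 (hQ j)
  have h4 := P.real_dist_triangle hv.1 hu.1 (hQ j)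
  have h5 : (P.dist u v : ℝ) ≤ P.dist u (Q j) := h
  rw [P.dist_comm (Q i) v] at h3
  rw [P.dist_comm v u] at h4
  have := le_max_left (P.radius Q i : ℝ) (P.radius Q j)
  have := le_max_right (P.radius Q i : ℝ) (P.radius Q j)
  linarith

/-- A point served by `k` is at least as close to another neighbour of `k` as to any point
that is served by a robot which is not a neighbour of `k`. -/
theorem exists_neighbor_closer (hQ : ∀ i, Q i ∈ P.X)
    (hB : ∀ p ∈ P.X, ∀ q ∈ P.X, P.dist p q ≤ B) {i k : Fin m} {u v : Loc n}
    (hu : u ∈ P.voronoi Q k) (hv : v ∈ P.voronoi Q i) (hik : i ∉ P.neighbors Q k) :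
    ∃ l ∈ P.neighbors Q k, l ≠ k ∧ P.dist u (Q l) ≤ P.dist u v := by
  have hm : 0 < m := i.pos
  have hvk : v ∉ P.voronoi Q k := fun h => hik (P.mem_neighbors_of_mem_voronoi hQ hB h hv)
  have e1 : ∀ᶠ ε in 𝓝[>] (0 : ℝ), ∀ l, (P.dist (Q k) (Q l) : ℝ) ≤
      3 * max (P.radius Q k : ℝ) (P.radius Q l) + 2 * ε → (P.dist (Q k) (Q l) : ℝ) ≤
      3 * max (P.radius Q k : ℝ) (P.radius Q l) :=
    eventually_all.2 fun l => eventually_le_of_le_add _ _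
  have e2 : ∀ᶠ ε in 𝓝[>] (0 : ℝ), ∀ l, (P.dist u (Q l) : ℝ) ≤ P.dist u v + 2 * ε →
      (P.dist u (Q l) : ℝ) ≤ P.dist u v :=
    eventually_all.2 fun l => eventually_le_of_le_add _ _
  obtain ⟨ε, ⟨h1, h2⟩, hε⟩ := ((e1.and e2).and self_mem_nhdsWithin).exists
  lift ε to ℝ≥0 using le_of_lt hε
  have hε' : 0 < ε := by exact_mod_cast hε
  -- The path from `u` to `v` leaves the cell of `k` between `a` and `b`. The robot `l` that serves
  -- `b` is the substitute: `d(q_k, q_l) ≤ r_k + r_l + ε`.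
  obtain ⟨a, b, ha, hb, hak, hbk, hab, hpath⟩ := P.exists_step_out hu.1 hv.1 hu hvk hε'
  obtain ⟨l, hl⟩ := P.exists_mem_voronoi hm Q hb
  have hlk : l ≠ k := by rintro rfl; exact hbk hl
  have hab' : (P.dist a b : ℝ) ≤ ε := hab
  have hpath' : (P.dist u a : ℝ) + P.dist b v ≤ P.dist u v + ε := by exact_mod_cast hpath
  have ra := P.dist_le_radius hQ hB hak
  have rb := P.dist_le_radius hQ hB hl
  have hblk : (P.dist b (Q l) : ℝ) ≤ P.dist b (Q k) := hl.2 k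
  have t1 := P.real_dist_triangle (hQ k) ha (hQ l)
  have t2 := P.real_dist_triangle ha hb (hQ l)
  rw [P.dist_comm (Q k) a] at t1
  have hlN : l ∈ P.neighbors Q k := by
    apply P.mem_neighbors_of_le
    apply h1 l
    have := le_max_left (P.radius Q k : ℝ) (P.radius Q l)
    have := le_max_right (P.radius Q k : ℝ) (P.radius Q l)
    linarith [NNReal.coe_nonneg (P.radius Q k)]
  refine ⟨l, hlN, hlk, NNReal.coe_le_coe.1 (h2 l ?_)⟩
  rcases le_or_gt (P.dist b (Q l) : ℝ) (P.dist b v) with h | h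
  · have t3 := P.real_dist_triangle hu.1 ha (hQ l)
    linarith
  -- If `v` were closer to `b` than `q_l` is, then `d(b, v) ≤ d(b, q_k) ≤ r_k + ε`, so `d(q_k, q_i)
  -- ≤ 2 r_k + r_i + 2 ε`, and `i` would be a neighbour of `k`.
  · exfalso
    apply hik
    apply P.mem_neighbors_of_le
    apply h1 i
    have rv := P.dist_le_radius hQ hB hv
    have t3 := P.real_dist_triangle hb ha (hQ k)
    have t4 := P.real_dist_triangle (hQ k) ha (hQ i)
    have t5 := P.real_dist_triangle ha hb (hQ i)
    have t6 := P.real_dist_triangle hb hv.1 (hQ i)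
    rw [P.dist_comm (Q k) a] at t4
    rw [P.dist_comm b a] at t3
    have := le_max_left (P.radius Q k : ℝ) (P.radius Q i)
    have := le_max_right (P.radius Q k : ℝ) (P.radius Q i)
    linarith

/-- The neighbour graph is connected. -/
theorem reflTransGen_neighbors (hQ : ∀ i, Q i ∈ P.X)
    (hB : ∀ p ∈ P.X, ∀ q ∈ P.X, P.dist p q ≤ B) (i k : Fin m) :
    Relation.ReflTransGen (fun a b => b ∈ P.neighbors Q a) i k := by
  by_contra hk
  set U : Set (Loc n) :=
    {p | ∃ l, Relation.ReflTransGen (fun a b => b ∈ P.neighbors Q a) i l ∧ p ∈ P.voronoi Q l}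
  have hiU : Q i ∈ U := ⟨i, .refl, P.self_mem_voronoi hQ i⟩
  have hkU : Q k ∉ U := by
    rintro ⟨l, hl, hkl⟩
    exact hk (hl.tail (P.mem_neighbors_of_mem_voronoi hQ hB hkl (P.self_mem_voronoi hQ k)))
  have e1 : ∀ᶠ ε in 𝓝[>] (0 : ℝ), ∀ j l, (P.dist (Q j) (Q l) : ℝ) ≤
      3 * max (P.radius Q j : ℝ) (P.radius Q l) + 2 * ε → (P.dist (Q j) (Q l) : ℝ) ≤
      3 * max (P.radius Q j : ℝ) (P.radius Q l) :=
    eventually_all.2 fun j => eventually_all.2 fun l => eventually_le_of_le_add _ _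
  obtain ⟨ε, h1, hε⟩ := (e1.and self_mem_nhdsWithin).exists
  lift ε to ℝ≥0 using le_of_lt hε
  have hε' : 0 < ε := by exact_mod_cast hε
  -- A path from `q_i` to `q_k` must jump out of the union `U` of the cells of the robots that `i`
  -- can reach. The server of the landing point is then a neighbour of a reachable robot, a
  -- contradiction.
  obtain ⟨a, b, ha, hb, ⟨j, hij, haj⟩, hbU, hab, -⟩ :=
    P.exists_step_out (hQ i) (hQ k) hiU hkU hε'
  obtain ⟨l, hl⟩ := P.exists_mem_voronoi i.pos Q hb
  refine hbU ⟨l, hij.tail (P.mem_neighbors_of_le (h1 j l ?_)), hl⟩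
  have hab' : (P.dist a b : ℝ) ≤ ε := hab
  have ra := P.dist_le_radius hQ hB haj
  have rb := P.dist_le_radius hQ hB hl
  have t1 := P.real_dist_triangle (hQ j) ha (hQ l)
  have t2 := P.real_dist_triangle ha hb (hQ l)
  rw [P.dist_comm (Q j) a] at t1
  have := le_max_left (P.radius Q j : ℝ) (P.radius Q l)
  have := le_max_right (P.radius Q j : ℝ) (P.radius Q l)
  linarith [NNReal.coe_nonneg (P.radius Q j), NNReal.coe_nonneg ε]

end Problem

end Coverage

/-! ### The graph of samples and its total cost -/

namespace Coverage

open Set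

namespace Problem.Sampling

variable {n : ℕ} {P : Problem n} (𝒮 : P.Sampling) {m : ℕ}

theorem mem_X (u : 𝒮.V) : (u : Loc n) ∈ P.X := 𝒮.subset_X u u.2

theorem loc_mem_X (q : 𝒮.Config m) (i : Fin m) : 𝒮.loc q i ∈ P.X := 𝒮.mem_X (q i)

theorem dist_near_le_dispersion {ζ : ℝ≥0} (hζ : 𝒮.IsDispersion ζ) {p : Loc n} (hp : p ∈ P.X) :
    P.dist p (𝒮.near p) ≤ ζ := by
  have : Nonempty 𝒮.V := ⟨𝒮.near p⟩
  exact (le_ciInf fun u : 𝒮.V => 𝒮.dist_near_le p hp u u.2).trans (hζ.1 ⟨p, hp, rfl⟩)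

/-- A finite dispersion bounds the diameter of the environment. -/
theorem exists_dist_le {ζ : ℝ≥0} (hζ : 𝒮.IsDispersion ζ) :
    ∃ B : ℝ≥0, ∀ p ∈ P.X, ∀ q ∈ P.X, P.dist p q ≤ B := by
  obtain ⟨b, hb⟩ := (Set.finite_range fun x : 𝒮.V × 𝒮.V => P.dist x.1 x.2).bddAbove
  refine ⟨ζ + (b + ζ), fun p hp q hq => ?_⟩
  have h1 := P.dist_triangle hp (𝒮.mem_X (𝒮.near p)) hq
  have h2 := P.dist_triangle (𝒮.mem_X (𝒮.near p)) (𝒮.mem_X (𝒮.near q)) hq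
  have h3 : P.dist (𝒮.near p) (𝒮.near q) ≤ b := hb ⟨(𝒮.near p, 𝒮.near q), rfl⟩
  have h4 := 𝒮.dist_near_le_dispersion hζ hq
  rw [P.dist_comm] at h4
  exact h1.trans (add_le_add (𝒮.dist_near_le_dispersion hζ hp)
    (h2.trans (add_le_add h3 h4)))

theorem c_nonneg (u v : 𝒮.V) : 0 ≤ 𝒮.c u v := NNReal.coe_nonneg _

theorem c_comm (u v : 𝒮.V) : 𝒮.c u v = 𝒮.c v u := by rw [c, c, P.dist_comm]

theorem c_triangle (u v x : 𝒮.V) : 𝒮.c u x ≤ 𝒮.c u v + 𝒮.c v x := by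
  have h := (P.strictMono_f.monotone (P.dist_triangle (𝒮.mem_X u) (𝒮.mem_X v) (𝒮.mem_X x))).trans
    (P.subadditive_f _ _)
  exact_mod_cast h

theorem c_le_c_iff {u v x y : 𝒮.V} : 𝒮.c u v ≤ 𝒮.c x y ↔ P.dist u v ≤ P.dist x y := by
  rw [c, c, NNReal.coe_le_coe, P.strictMono_f.le_iff_le]

theorem w_nonneg (u : 𝒮.V) : 0 ≤ 𝒮.w u := ENNReal.toReal_nonneg

theorem minCost_le {u x : 𝒮.V} {T : Set 𝒮.V} (hx : x ∈ T) : 𝒮.minCost u T ≤ 𝒮.c u x :=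
  csInf_le ⟨0, by rintro _ ⟨y, -, rfl⟩; exact 𝒮.c_nonneg u y⟩ ⟨x, hx, rfl⟩

theorem le_minCost {u : 𝒮.V} {T : Set 𝒮.V} (hT : T.Nonempty) {a : ℝ}
    (h : ∀ x ∈ T, a ≤ 𝒮.c u x) : a ≤ 𝒮.minCost u T :=
  le_csInf (hT.image _) (by rintro _ ⟨y, hy, rfl⟩; exact h y hy)

theorem minCost_eq {u x : 𝒮.V} {T : Set 𝒮.V} (hx : x ∈ T) (h : ∀ y ∈ T, 𝒮.c u x ≤ 𝒮.c u y) :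
    𝒮.minCost u T = 𝒮.c u x :=
  le_antisymm (𝒮.minCost_le hx) (𝒮.le_minCost ⟨x, hx⟩ h)

/-- A nonempty set may be replaced by a subset that contains a closest point. -/
theorem minCost_eq_of_subset {u : 𝒮.V} {T T' : Set 𝒮.V} (hT' : T'.Nonempty) (hT : T ⊆ T')
    (h : ∀ y ∈ T', ∃ x ∈ T, 𝒮.c u x ≤ 𝒮.c u y) : 𝒮.minCost u T = 𝒮.minCost u T' := by
  obtain ⟨y, hy⟩ := hT'
  obtain ⟨x, hx, -⟩ := h y hy
  refine le_antisymm (𝒮.le_minCost ⟨y, hy⟩ fun z hz => ?_)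
    (𝒮.le_minCost ⟨x, hx⟩ fun z hz => 𝒮.minCost_le (hT hz))
  obtain ⟨z', hz', hle⟩ := h z hz
  exact (𝒮.minCost_le hz').trans hle

theorem mem_part {q : 𝒮.Config m} {i : Fin m} {u : 𝒮.V} : u ∈ 𝒮.part q i ↔
    ∀ j, j ≠ i → 𝒮.c u (q i) < 𝒮.c u (q j) ∨ (𝒮.c u (q i) = 𝒮.c u (q j) ∧ i < j) := by
  simp [part]

theorem c_le_of_mem_part {q : 𝒮.Config m} {i : Fin m} {u : 𝒮.V} (h : u ∈ 𝒮.part q i)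
    (j : Fin m) : 𝒮.c u (q i) ≤ 𝒮.c u (q j) := by
  by_cases hj : j = i
  · rw [hj]
  · rcases 𝒮.mem_part.1 h j hj with h | h
    · exact h.le
    · exact h.1.le

theorem mem_voronoi_of_mem_part {q : 𝒮.Config m} {i : Fin m} {u : 𝒮.V} (h : u ∈ 𝒮.part q i) :
    (u : Loc n) ∈ P.voronoi (𝒮.loc q) i :=
  ⟨𝒮.mem_X u, fun j => 𝒮.c_le_c_iff.1 (𝒮.c_le_of_mem_part h j)⟩

/-- The parts of the robots partition the vertices. -/
theorem exists_owner (hm : 0 < m) (q : 𝒮.Config m) :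
    ∃ own : 𝒮.V → Fin m, ∀ u j, u ∈ 𝒮.part q j ↔ own u = j := by
  have : Nonempty (Fin m) := ⟨⟨0, hm⟩⟩
  choose own hown using fun u : 𝒮.V =>
    Finite.exists_min fun j => toLex (𝒮.c u (q j), j)
  have key : ∀ u, u ∈ 𝒮.part q (own u) := fun u => by
    refine 𝒮.mem_part.2 fun j hj => ?_
    rcases (Prod.Lex.le_iff).1 (hown u j) with h | h
    · exact Or.inl h
    · exact Or.inr ⟨h.1, lt_of_le_of_ne h.2 hj.symm⟩
  refine ⟨own, fun u j => ⟨fun h => ?_, fun h => h ▸ key u⟩⟩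
  by_contra hne
  rcases 𝒮.mem_part.1 h _ hne with h1 | h1 <;>
  rcases 𝒮.mem_part.1 (key u) _ (Ne.symm hne) with h2 | h2
  · exact lt_asymm h1 h2
  · exact h1.ne h2.1.symm
  · exact h2.ne h1.1.symm
  · exact lt_asymm h1.2 h2.2

theorem sum_part (q : 𝒮.Config m) (hm : 0 < m) (F : 𝒮.V → ℝ) :
    ∑ u, F u = ∑ j, ∑ u ∈ 𝒮.part q j, F u := by
  classical
  obtain ⟨own, hown⟩ := 𝒮.exists_owner hm q
  rw [← Finset.sum_fiberwise Finset.univ own F]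
  refine Finset.sum_congr rfl fun j _ => Finset.sum_congr ?_ fun _ _ => rfl
  ext u
  simp [hown]

/-- The cost of a configuration on the graph of the samples. -/
noncomputable def total (q : 𝒮.Config m) : ℝ := ∑ u, 𝒮.w u * 𝒮.minCost u (range q)

theorem minCost_range_of_mem_part {q : 𝒮.Config m} {i : Fin m} {u : 𝒮.V}
    (h : u ∈ 𝒮.part q i) : 𝒮.minCost u (range q) = 𝒮.c u (q i) :=
  𝒮.minCost_eq ⟨i, rfl⟩ (by rintro _ ⟨j, rfl⟩; exact 𝒮.c_le_of_mem_part h j)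

/-- The difference of the costs of two configurations, as a sum over the parts of the second. -/
theorem total_sub_total (hm : 0 < m) (q' q : 𝒮.Config m) : 𝒮.total q' - 𝒮.total q =
    ∑ j, ∑ u ∈ 𝒮.part q j, 𝒮.w u * (𝒮.minCost u (range q') - 𝒮.c u (q j)) := by
  rw [total, total, ← Finset.sum_sub_distrib, 𝒮.sum_part q hm]
  refine Finset.sum_congr rfl fun j _ => Finset.sum_congr rfl fun u hu => ?_
  rw [𝒮.minCost_range_of_mem_part hu, mul_sub]

theorem mem_range_update {q : 𝒮.Config m} {k : Fin m} {v x : 𝒮.V} :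
    x ∈ range (Function.update q k v) ↔ x = v ∨ ∃ j, j ≠ k ∧ x = q j := by
  constructor
  · rintro ⟨j, rfl⟩
    by_cases h : j = k
    · subst h; simp
    · exact Or.inr ⟨j, h, by simp [h]⟩
  · rintro (rfl | ⟨j, h, rfl⟩)
    · exact ⟨k, by simp⟩
    · exact ⟨j, by simp [h]⟩

/-! ### Local computations give exact changes of the total cost -/

section Exact

variable {𝒮} {B : ℝ≥0} {q : 𝒮.Config m} {i j k : Fin m} {u v : 𝒮.V}

theorem mem_nbr_comm : j ∈ 𝒮.nbr q i ↔ i ∈ 𝒮.nbr q j := P.mem_neighbors_comm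

theorem c_le_of_notMem_nbr (hB : ∀ p ∈ P.X, ∀ q ∈ P.X, P.dist p q ≤ B)
    (hv : v ∈ 𝒮.part q i) (hu : u ∈ 𝒮.part q j) (hij : j ∉ 𝒮.nbr q i) :
    𝒮.c u (q j) ≤ 𝒮.c u v := by
  by_contra h
  refine hij (P.mem_neighbors_of_closer (𝒮.loc_mem_X q) hB (𝒮.mem_voronoi_of_mem_part hv)
    (𝒮.mem_voronoi_of_mem_part hu) ?_)
  exact 𝒮.c_le_c_iff.1 (not_le.1 h).le

/-- Vertices served by `k` can pass to a neighbour of `k` rather than to a vertex served by a robot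
which is not a neighbour. -/
theorem exists_mem_others_of_notMem_nbr (hB : ∀ p ∈ P.X, ∀ q ∈ P.X, P.dist p q ≤ B)
    (hu : u ∈ 𝒮.part q k) (hv : (v : Loc n) ∈ P.voronoi (𝒮.loc q) i) (hik : i ∉ 𝒮.nbr q k) :
    ∃ x ∈ 𝒮.others q k, 𝒮.c u x ≤ 𝒮.c u v := by
  obtain ⟨l, hl, hlk, hle⟩ := P.exists_neighbor_closer (𝒮.loc_mem_X q) hB
    (𝒮.mem_voronoi_of_mem_part hu) hv hik
  exact ⟨q l, ⟨l, hl, hlk, rfl⟩, 𝒮.c_le_c_iff.2 hle⟩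

theorem exists_mem_others (hB : ∀ p ∈ P.X, ∀ q ∈ P.X, P.dist p q ≤ B)
    (hu : u ∈ 𝒮.part q k) (hj : j ≠ k) : ∃ x ∈ 𝒮.others q k, 𝒮.c u x ≤ 𝒮.c u (q j) := by
  by_cases h : j ∈ 𝒮.nbr q k
  · exact ⟨q j, ⟨j, h, hj, rfl⟩, le_rfl⟩
  · exact exists_mem_others_of_notMem_nbr hB hu
      (P.self_mem_voronoi (Q := 𝒮.loc q) (𝒮.loc_mem_X q) j) h

theorem others_subset_range_update : 𝒮.others q k ⊆ range (Function.update q k v) := by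
  rintro _ ⟨j, -, hj, rfl⟩
  exact 𝒮.mem_range_update.2 (Or.inr ⟨j, hj, rfl⟩)

theorem minCost_insert_others (hB : ∀ p ∈ P.X, ∀ q ∈ P.X, P.dist p q ≤ B)
    (hu : u ∈ 𝒮.part q k) (v : 𝒮.V) :
    𝒮.minCost u (insert v (𝒮.others q k)) = 𝒮.minCost u (range (Function.update q k v)) := by
  have hv : v ∈ range (Function.update q k v) := 𝒮.mem_range_update.2 (Or.inl rfl)
  refine 𝒮.minCost_eq_of_subset ⟨v, hv⟩ (insert_subset hv others_subset_range_update)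
    fun y hy => ?_
  rcases 𝒮.mem_range_update.1 hy with rfl | ⟨j, hj, rfl⟩
  · exact ⟨y, mem_insert _ _, le_rfl⟩
  · obtain ⟨x, hx, hle⟩ := exists_mem_others hB hu hj
    exact ⟨x, mem_insert_of_mem _ hx, hle⟩

/-- The best robot of `u` stays in place, so only the new position `v` can compete with it. -/
theorem minCost_update_of_ne (hu : u ∈ 𝒮.part q j) (hj : j ≠ k) (v : 𝒮.V) :
    𝒮.minCost u (range (Function.update q k v)) = min (𝒮.c u v) (𝒮.c u (q j)) := by
  have hv : v ∈ range (Function.update q k v) := 𝒮.mem_range_update.2 (Or.inl rfl)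
  refine le_antisymm (le_min (𝒮.minCost_le hv)
    (𝒮.minCost_le (𝒮.mem_range_update.2 (Or.inr ⟨j, hj, rfl⟩)))) (𝒮.le_minCost ⟨v, hv⟩ ?_)
  intro x hx
  rcases 𝒮.mem_range_update.1 hx with rfl | ⟨l, -, rfl⟩
  · exact min_le_left _ _
  · exact (min_le_right _ _).trans (𝒮.c_le_of_mem_part hu l)

/-- The change `δ_v` is the change of the total cost. -/
theorem delta_eq (hB : ∀ p ∈ P.X, ∀ q ∈ P.X, P.dist p q ≤ B) (hv : v ∈ 𝒮.part q i) :
    𝒮.delta q i v = 𝒮.total (Function.update q i v) - 𝒮.total q := by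
  rw [𝒮.total_sub_total i.pos, delta]
  have hi : i ∈ 𝒮.nbr q i := P.mem_neighbors_iff.2 (by
    rw [P.dist_self (𝒮.loc_mem_X q i)]; simp)
  rw [← Finset.sum_subset (Finset.subset_univ (𝒮.nbr q i))]
  · refine Finset.sum_congr rfl fun j hj => Finset.sum_congr rfl fun u hu => ?_
    by_cases h : j = i
    · subst h
      rw [minCost_insert_others hB hu]
    · rw [𝒮.minCost_eq_of_subset (T' := range (Function.update q i v)) ⟨v, ?_⟩ ?_ ?_]
      · exact 𝒮.mem_range_update.2 (Or.inl rfl)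
      · exact insert_subset (𝒮.mem_range_update.2 (Or.inl rfl)) others_subset_range_update
      · intro y hy
        rcases 𝒮.mem_range_update.1 hy with rfl | ⟨l, -, rfl⟩
        · exact ⟨y, mem_insert _ _, le_rfl⟩
        · exact ⟨q j, mem_insert_of_mem _ ⟨j, hj, h, rfl⟩, 𝒮.c_le_of_mem_part hu l⟩
  -- The part of a robot that is not a neighbour contributes nothing: its robot stays and `v` is no
  -- closer.
  · intro j _ hj
    refine Finset.sum_eq_zero fun u hu => ?_
    rw [minCost_update_of_ne hu (by rintro rfl; exact hj hi),
      min_eq_right (c_le_of_notMem_nbr hB hv hu hj), sub_self, mul_zero]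

theorem sum_gained (q : 𝒮.Config m) (j : Fin m) (v : 𝒮.V) :
    ∑ u ∈ 𝒮.gained q j v, 𝒮.w u * (𝒮.c u v - 𝒮.c u (q j)) =
      ∑ u ∈ 𝒮.part q j, 𝒮.w u * (min (𝒮.c u v) (𝒮.c u (q j)) - 𝒮.c u (q j)) := by
  classical
  rw [gained, Finset.sum_filter]
  refine Finset.sum_congr rfl fun u _ => ?_
  split_ifs with h
  · rw [min_eq_left h.le]
  · rw [min_eq_right (not_lt.1 h), sub_self, mul_zero]

theorem rho_eq (hB : ∀ p ∈ P.X, ∀ q ∈ P.X, P.dist p q ≤ B) (hv : v ∈ 𝒮.part q i) :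
    𝒮.rho q i v =
      ∑ j, ∑ u ∈ 𝒮.part q j, 𝒮.w u * (min (𝒮.c u v) (𝒮.c u (q j)) - 𝒮.c u (q j)) := by
  rw [rho, ← Finset.sum_subset (Finset.subset_univ (𝒮.nbr q i))]
  · exact Finset.sum_congr rfl fun j _ => sum_gained q j v
  · intro j _ hj
    refine Finset.sum_eq_zero fun u hu => ?_
    rw [min_eq_right (c_le_of_notMem_nbr hB hv hu hj), sub_self, mul_zero]

/-- A relocation of `k` to `v` is split into adding a robot at `v`, which is `ρ_v`, and then
deleting `k`, which affects only the part of `k`. Both forms of `ℓ` are evaluations of the second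
term. -/
theorem rho_add_eq (hB : ∀ p ∈ P.X, ∀ q ∈ P.X, P.dist p q ≤ B) (hv : v ∈ 𝒮.part q i)
    (k : Fin m) :
    𝒮.rho q i v + ∑ u ∈ 𝒮.part q k, 𝒮.w u * (𝒮.minCost u (range (Function.update q k v)) -
      min (𝒮.c u v) (𝒮.c u (q k))) = 𝒮.total (Function.update q k v) - 𝒮.total q := by
  rw [rho_eq hB hv, 𝒮.total_sub_total i.pos, ← Finset.add_sum_erase _ _ (Finset.mem_univ k),
    ← Finset.add_sum_erase (a := k) Finset.univ (fun j => ∑ u ∈ 𝒮.part q j, 𝒮.w u *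
      (𝒮.minCost u (range (Function.update q k v)) - 𝒮.c u (q j))) (Finset.mem_univ k),
    add_right_comm, ← Finset.sum_add_distrib]
  congr 1
  · exact Finset.sum_congr rfl fun u _ => by ring
  · refine Finset.sum_congr rfl fun j hj => Finset.sum_congr rfl fun u hu => ?_
    rw [minCost_update_of_ne hu (Finset.ne_of_mem_erase hj)]

/-- The vertices of `R_k(v)` have already passed to `v` in `ρ_v` and lose nothing when `k` is
deleted, so they may be left out. -/
theorem rho_add_ellNear (hB : ∀ p ∈ P.X, ∀ q ∈ P.X, P.dist p q ≤ B) (hv : v ∈ 𝒮.part q i)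
    (k : Fin m) :
    𝒮.rho q i v + 𝒮.ellNear q k v = 𝒮.total (Function.update q k v) - 𝒮.total q := by
  classical
  rw [← rho_add_eq hB hv k, ellNear, gained]
  congr 1
  rw [Finset.sdiff_eq_filter, Finset.sum_filter]
  refine Finset.sum_congr rfl fun u hu => ?_
  simp only [Finset.mem_filter, hu, true_and]
  split_ifs with h
  · rw [eq_comm, min_eq_left h.le, 𝒮.minCost_eq (x := v) (𝒮.mem_range_update.2 (Or.inl rfl)), sub_self,
      mul_zero]
    intro y hy
    rcases 𝒮.mem_range_update.1 hy with rfl | ⟨l, -, rfl⟩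
    · exact le_rfl
    · exact h.le.trans (𝒮.c_le_of_mem_part hu l)
  · rw [minCost_insert_others hB hu, min_eq_right (not_lt.1 h)]

/-- When `k` is not a neighbour of `i`, no vertex of `k` gains from `v`, and some neighbour of `k`
is at least as close as `v`; so `v` drops out of the minimum. In particular `others q k` is nonempty
as soon as `k` serves a vertex, and the default value of `sInf` at the empty set plays no role. -/
theorem rho_add_ellFar (hB : ∀ p ∈ P.X, ∀ q ∈ P.X, P.dist p q ≤ B) (hv : v ∈ 𝒮.part q i)
    (hk : k ∉ 𝒮.nbr q i) :
    𝒮.rho q i v + 𝒮.ellFar q k = 𝒮.total (Function.update q k v) - 𝒮.total q := by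
  rw [← rho_add_eq hB hv k, ellFar]
  congr 1
  refine Finset.sum_congr rfl fun u hu => ?_
  rw [min_eq_right (c_le_of_notMem_nbr hB hv hu hk)]
  congr 2
  refine 𝒮.minCost_eq_of_subset ⟨v, 𝒮.mem_range_update.2 (Or.inl rfl)⟩
    others_subset_range_update fun y hy => ?_
  rcases 𝒮.mem_range_update.1 hy with rfl | ⟨j, hj, rfl⟩
  · exact exists_mem_others_of_notMem_nbr hB hu (𝒮.mem_voronoi_of_mem_part hv)
      (fun h => hk (mem_nbr_comm.1 h))
  · exact exists_mem_others hB hu hj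

end Exact

end Problem.Sampling

end Coverage

/-! ### Propagation of messages -/

namespace Coverage

open Set

namespace Problem.Sampling

variable {n : ℕ} {P : Problem n} {𝒮 : P.Sampling} {m : ℕ}

section Flood

variable {ε₀ : ℝ≥0} {q : 𝒮.Config m} {i k : Fin m} {h t : ℕ}

theorem reached_zero : 𝒮.Reached ε₀ q i 0 k ↔ k = i := by
  simp [Reached, flood]

theorem reached_succ : 𝒮.Reached ε₀ q i (h + 1) k ↔ k ∉ (𝒮.flood ε₀ q i h).2 ∧
    ∃ p, 𝒮.Reached ε₀ q i h p ∧ 𝒮.Forwards ε₀ q i h p ∧ k ∈ 𝒮.nbr q p := by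
  simp [Reached, flood]

theorem mem_flood_snd : k ∈ (𝒮.flood ε₀ q i h).2 ↔ ∃ t ≤ h, 𝒮.Reached ε₀ q i t k := by
  induction h with
  | zero => simp [Reached, flood]
  | succ h ih =>
    have : k ∈ (𝒮.flood ε₀ q i (h + 1)).2 ↔
        k ∈ (𝒮.flood ε₀ q i h).2 ∨ 𝒮.Reached ε₀ q i (h + 1) k := by
      rw [Reached, flood]; exact Finset.mem_union
    rw [this, ih]
    constructor
    · rintro (⟨t, ht, hr⟩ | hr)
      · exact ⟨t, ht.trans h.le_succ, hr⟩
      · exact ⟨h + 1, le_rfl, hr⟩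
    · rintro ⟨t, ht, hr⟩
      rcases Nat.le_succ_iff.1 ht with ht | rfl
      · exact Or.inl ⟨t, ht, hr⟩
      · exact Or.inr hr

theorem not_reached_of_lt (hth : t < h) (ht : 𝒮.Reached ε₀ q i t k) :
    ¬ 𝒮.Reached ε₀ q i h k := by
  obtain ⟨h, rfl⟩ : ∃ h', h = h' + 1 := ⟨h - 1, by omega⟩
  intro hr
  exact (reached_succ.1 hr).1 (mem_flood_snd.2 ⟨t, Nat.lt_succ_iff.1 hth, ht⟩)

/-- The smallest counter with which a robot is reached is unique. -/
theorem reached_unique (ht : 𝒮.Reached ε₀ q i t k) (hh : 𝒮.Reached ε₀ q i h k) : t = h := by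
  rcases lt_trichotomy t h with hlt | heq | hlt
  · exact absurd hh (not_reached_of_lt hlt ht)
  · exact heq
  · exact absurd ht (not_reached_of_lt hlt hh)

theorem reached_step {p : Fin m} (hp : 𝒮.Reached ε₀ q i h p) (hf : 𝒮.Forwards ε₀ q i h p)
    (hk : k ∈ 𝒮.nbr q p) : ∃ t ≤ h + 1, 𝒮.Reached ε₀ q i t k := by
  by_cases hmem : k ∈ (𝒮.flood ε₀ q i h).2
  · obtain ⟨t, ht, hr⟩ := mem_flood_snd.1 hmem
    exact ⟨t, ht.trans h.le_succ, hr⟩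
  · exact ⟨h + 1, le_rfl, reached_succ.2 ⟨hmem, p, hp, hf, hk⟩⟩

/-- The originator always forwards, so its neighbours have counter at most one. This is what makes
`ellFar` the right formula for larger counters. -/
theorem notMem_nbr_of_reached (hh : 2 ≤ h) (hr : 𝒮.Reached ε₀ q i h k) : k ∉ 𝒮.nbr q i := by
  intro hk
  obtain ⟨t, ht, hrt⟩ := reached_step (reached_zero.2 rfl) (Or.inl rfl) hk
  have := reached_unique hrt hr
  omega

/-- The parents of a reached robot form a chain that starts at the originator. -/
theorem exists_chain (hr : 𝒮.Reached ε₀ q i h k) :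
    ∃ r : ℕ → Fin m, r 0 = i ∧ r h = k ∧ (∀ t ≤ h, 𝒮.Reached ε₀ q i t (r t)) ∧
      ∀ t < h, 𝒮.Forwards ε₀ q i t (r t) ∧ r (t + 1) ∈ 𝒮.nbr q (r t) := by
  induction h generalizing k with
  | zero =>
    have := reached_zero.1 hr
    subst this
    exact ⟨fun _ => k, rfl, rfl, fun t ht => by obtain rfl := Nat.le_zero.1 ht; exact hr,
      fun t ht => absurd ht t.not_lt_zero⟩
  | succ h ih =>
    obtain ⟨-, p, hp, hf, hk⟩ := reached_succ.1 hr
    obtain ⟨r, h0, hrh, hreach, hpar⟩ := ih hp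
    refine ⟨fun t => if t ≤ h then r t else k, by simp [h0], by simp, fun t ht => ?_,
      fun t ht => ?_⟩
    · rcases Nat.le_succ_iff.1 ht with ht | rfl
      · simpa [ht] using hreach t ht
      · simpa using hr
    · rcases (Nat.lt_succ_iff.1 ht).lt_or_eq with hlt | rfl
      · simpa [hlt.le, Nat.succ_le_iff.2 hlt] using hpar t hlt
      · simpa [hrh] using ⟨hf, hk⟩

/-- If no robot accepts, then the message reaches every robot. -/
theorem exists_reached {B : ℝ≥0} (hB : ∀ p ∈ P.X, ∀ q ∈ P.X, P.dist p q ≤ B)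
    (hacc : ∀ h k, 1 ≤ h → 𝒮.Reached ε₀ q i h k → ¬ 𝒮.Accepts ε₀ q i h k) (k : Fin m) :
    ∃ h, 𝒮.Reached ε₀ q i h k := by
  induction P.reflTransGen_neighbors (𝒮.loc_mem_X q) hB i k with
  | refl => exact ⟨0, reached_zero.2 rfl⟩
  | @tail p k _ hk ih =>
    obtain ⟨h, hp⟩ := ih
    have hf : 𝒮.Forwards ε₀ q i h p := by
      rcases Nat.eq_zero_or_pos h with h0 | h0
      · exact Or.inl h0
      · exact Or.inr (hacc h p h0 hp)
    obtain ⟨t, -, ht⟩ := reached_step hp hf hk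
    exact ⟨t, ht⟩

/-- The number computed by a reached robot is the change of the total cost. -/
theorem value_eq {B : ℝ≥0} (hB : ∀ p ∈ P.X, ∀ q ∈ P.X, P.dist p q ≤ B) {v : 𝒮.V}
    (hv : v ∈ 𝒮.part q i) (hh : 1 ≤ h) (hr : 𝒮.Reached ε₀ q i h k) :
    𝒮.value q i h k v = 𝒮.total (Function.update q k v) - 𝒮.total q := by
  rw [value]
  split_ifs with h1
  · exact rho_add_ellNear hB hv k
  · exact rho_add_ellFar hB hv (notMem_nbr_of_reached (by omega) hr)

end Flood

/-! ### Effect and availability of local moves -/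

section Moves

variable {ε₀ : ℝ≥0} {q q' : 𝒮.Config m} {i : Fin m}

/-- Moving the robots along a chain has the effect of moving its last robot to the new vertex. -/
theorem range_chain {h : ℕ} {r : ℕ → Fin m} {v : 𝒮.V}
    (hr : ∀ s ≤ h, ∀ t ≤ h, r s = r t → s = t) (hstart : q' (r 0) = v)
    (hchain : ∀ t < h, q' (r (t + 1)) = q (r t)) (hstay : ∀ j, (∀ t ≤ h, j ≠ r t) → q' j = q j) :
    range q' = range (Function.update q (r h) v) := by
  apply Subset.antisymm
  · rintro _ ⟨j, rfl⟩
    rw [𝒮.mem_range_update]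
    by_cases hj : ∀ t ≤ h, j ≠ r t
    · exact Or.inr ⟨j, hj h le_rfl, hstay j hj⟩
    · push Not at hj
      obtain ⟨t, ht, rfl⟩ := hj
      cases t with
      | zero => exact Or.inl hstart
      | succ t =>
        refine Or.inr ⟨r t, fun heq => ?_, hchain t ht⟩
        have := hr t (by omega) h le_rfl heq
        omega
  · intro x hx
    rcases 𝒮.mem_range_update.1 hx with rfl | ⟨j, hj, rfl⟩
    · exact ⟨r 0, hstart⟩
    · by_cases hjr : ∀ t ≤ h, j ≠ r t
      · exact ⟨j, hstay j hjr⟩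
      · push Not at hjr
        obtain ⟨t, ht, rfl⟩ := hjr
        have : t ≠ h := by rintro rfl; exact hj rfl
        exact ⟨r (t + 1), hchain t (by omega)⟩

/-- Every local move decreases the total cost by the threshold. -/
theorem total_le_of_localMove {B : ℝ≥0} (hB : ∀ p ∈ P.X, ∀ q ∈ P.X, P.dist p q ≤ B)
    (hmove : 𝒮.LocalMove ε₀ i q q') : 𝒮.total q' ≤ 𝒮.total q - ε₀ := by
  cases hmove with
  | single v hv improves best move =>
    rw [delta_eq hB hv] at improves
    rw [move]
    linarith
  | chain noSingle h hpos r start reached parent v hv improves best move_start move_chain stay =>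
    rw [value_eq hB hv hpos (reached h le_rfl)] at improves
    have hrange := range_chain (q := q) (q' := q') (v := v) (r := r) (h := h)
      (fun s hs t ht heq => reached_unique (reached s hs) (heq ▸ reached t ht))
      (by rw [start, move_start]) move_chain stay
    have : 𝒮.total q' = 𝒮.total (Function.update q (r h) v) := by
      rw [total, total, hrange]
    linarith

/-- A robot without a local move cannot improve by moving to a vertex of its part. -/
theorem delta_gt_of_forall_not_localMove (hno : ∀ q', ¬ 𝒮.LocalMove ε₀ i q q') {v : 𝒮.V}
    (hv : v ∈ 𝒮.part q i) : -(ε₀ : ℝ) < 𝒮.delta q i v := by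
  by_contra hle
  obtain ⟨x, hx, hmin⟩ := Finset.exists_min_image (𝒮.part q i) (𝒮.delta q i) ⟨v, hv⟩
  exact hno _ (.single x hx ((hmin v hv).trans (not_lt.1 hle)) hmin rfl)

/-- If a robot has no local move, then no robot accepts its message. -/
theorem value_gt_of_forall_not_localMove (hno : ∀ q', ¬ 𝒮.LocalMove ε₀ i q q') {v : 𝒮.V}
    (hv : v ∈ 𝒮.part q i) {h : ℕ} {k : Fin m} (hh : 1 ≤ h) (hr : 𝒮.Reached ε₀ q i h k) :
    -(ε₀ : ℝ) < 𝒮.value q i h k v := by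
  classical
  by_contra hle
  set T : Set ℝ := {x | ∃ h k v, 1 ≤ h ∧ 𝒮.Reached ε₀ q i h k ∧ v ∈ 𝒮.part q i ∧
    x = 𝒮.value q i h k v}
  -- Counters range over all of `ℕ`, but a value depends on its counter only through whether it
  -- equals one.
  have hfin : T.Finite := by
    refine (Set.finite_range fun y : Bool × Fin m × 𝒮.V =>
      𝒮.rho q i y.2.2 + if y.1 then 𝒮.ellNear q y.2.1 y.2.2 else 𝒮.ellFar q y.2.1).subset ?_
    rintro _ ⟨h, k, v, -, -, -, rfl⟩
    exact ⟨(decide (h = 1), k, v), by simp [value]⟩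
  obtain ⟨x, ⟨h', k', v', hh', hr', hv', rfl⟩, hmin⟩ :=
    Set.exists_min_image T id hfin ⟨_, h, k, v, hh, hr, hv, rfl⟩
  obtain ⟨r, h0, rfl, hreach, hpar⟩ := exists_chain hr'
  have hinj : ∀ s ≤ h', ∀ t ≤ h', r s = r t → s = t := fun s hs t ht heq =>
    reached_unique (hreach s hs) (heq ▸ hreach t ht)
  -- The new positions along the chain: `r 0` goes to `v'` and `r (t + 1)` to the old place of `r
  -- t`. They are well defined on robots because `r` is injective up to `h'`.
  set pos : ℕ → 𝒮.V := fun t => Nat.casesOn t v' fun t => q (r t)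
  set qn : 𝒮.Config m := fun j => if hj : ∃ t ≤ h', j = r t then pos hj.choose else q j with hqn
  have hqr : ∀ t ≤ h', qn (r t) = pos t := fun t ht => by
    have hex : ∃ s ≤ h', r t = r s := ⟨t, ht, rfl⟩
    have hs := hex.choose_spec
    simp only [hqn, dif_pos hex]
    rw [← hinj t ht _ hs.1 hs.2]
  refine hno qn (.chain (fun v' hv' => not_le.2 (delta_gt_of_forall_not_localMove hno hv')) h' hh'
    r h0 hreach hpar v' hv' ?_ ?_ ?_ ?_ ?_)
  · exact (hmin _ ⟨h, k, v, hh, hr, hv, rfl⟩).trans (not_lt.1 hle)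
  · exact fun h'' k'' hh'' hr'' v'' hv'' => hmin _ ⟨h'', k'', v'', hh'', hr'', hv'', rfl⟩
  · exact (congrArg qn h0.symm).trans (hqr 0 (Nat.zero_le _))
  · exact fun t ht => hqr (t + 1) ht
  · intro j hj
    have : ¬ ∃ t ≤ h', j = r t := by
      rintro ⟨t, ht, rfl⟩
      exact hj t ht rfl
    simp only [hqn, dif_neg this]

end Moves

/-! ### Termination and local optimality of the result -/

section Run

variable {ε₀ : ℝ≥0}

theorem wellFounded_total (𝒮 : P.Sampling) (m : ℕ) :
    WellFounded fun a b : 𝒮.Config m => 𝒮.total a < 𝒮.total b :=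
  have : IsTrans (𝒮.Config m) fun a b => 𝒮.total a < 𝒮.total b := ⟨fun _ _ _ => lt_trans⟩
  have : Std.Irrefl fun a b : 𝒮.Config m => 𝒮.total a < 𝒮.total b := ⟨fun _ => lt_irrefl _⟩
  Finite.wellFounded_of_trans_of_irrefl _

theorem exists_localMoves {B : ℝ≥0} (hB : ∀ p ∈ P.X, ∀ q ∈ P.X, P.dist p q ≤ B) (hε₀ : 0 < ε₀)
    (i : Fin m) (q : 𝒮.Config m) : ∃ q', Relation.ReflTransGen (𝒮.LocalMove ε₀ i) q q' ∧
      ∀ q'', ¬ 𝒮.LocalMove ε₀ i q' q'' := by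
  induction q using (wellFounded_total 𝒮 m).induction with
  | _ q ih =>
    by_cases hq : ∃ q', 𝒮.LocalMove ε₀ i q q'
    · obtain ⟨q', hq'⟩ := hq
      have h1 := total_le_of_localMove hB hq'
      have h2 : (0 : ℝ) < ε₀ := hε₀
      obtain ⟨q'', hrun, hdone⟩ := ih q' (by linarith)
      exact ⟨q'', hrun.head hq', hdone⟩
    · exact ⟨q, .refl, fun q'' hq'' => hq ⟨q'', hq''⟩⟩

theorem total_lt_of_transGen {B : ℝ≥0} (hB : ∀ p ∈ P.X, ∀ q ∈ P.X, P.dist p q ≤ B)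
    (hε₀ : 0 < ε₀) {i : Fin m} {q q' : 𝒮.Config m}
    (hrun : Relation.TransGen (𝒮.LocalMove ε₀ i) q q') : 𝒮.total q' < 𝒮.total q := by
  have h2 : (0 : ℝ) < ε₀ := hε₀
  induction hrun with
  | single h => linarith [total_le_of_localMove hB h]
  | tail _ h ih => linarith [total_le_of_localMove hB h]

/-- From every state some execution reaches a state without active robots. -/
theorem exists_turns {B : ℝ≥0} (hB : ∀ p ∈ P.X, ∀ q ∈ P.X, P.dist p q ≤ B) (hε₀ : 0 < ε₀)
    (q : 𝒮.Config m) (A : Finset (Fin m)) :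
    ∃ q', Relation.ReflTransGen (𝒮.Turn ε₀) (q, A) (q', ∅) := by
  -- Lexicographic induction: a turn lowers `total`, or it keeps the configuration and removes a
  -- robot from the active set.
  induction q using (wellFounded_total 𝒮 m).induction generalizing A with
  | _ q ih =>
    induction A using Finset.strongInduction with
    | H A ihA =>
      rcases A.eq_empty_or_nonempty with rfl | ⟨i, hi⟩
      · exact ⟨q, .refl⟩
      by_cases guard : 0 < ∑ u ∈ 𝒮.part q i, 𝒮.c u (q i)
      · obtain ⟨q', hrun, hdone⟩ := exists_localMoves hB hε₀ i q
        rcases Relation.reflTransGen_iff_eq_or_transGen.1 hrun with rfl | hrun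
        · obtain ⟨q'', hq''⟩ := ihA _ (Finset.erase_ssubset hi)
          exact ⟨q'', hq''.head (.noMove _ A i hi guard hdone)⟩
        · obtain ⟨q'', hq''⟩ := ih q' (total_lt_of_transGen hB hε₀ hrun) (Finset.univ.erase i)
          exact ⟨q'', hq''.head (.moves q q' A i hi guard hrun hdone)⟩
      · obtain ⟨q'', hq''⟩ := ihA _ (Finset.erase_ssubset hi)
        exact ⟨q'', hq''.head (.skip q A i hi guard)⟩

/-- In a returned configuration no robot has a reason to move. -/
theorem inactive_of_returns {q₀ q : 𝒮.Config m} (hret : 𝒮.Returns ε₀ q₀ q) (i : Fin m) :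
    (¬ 0 < ∑ u ∈ 𝒮.part q i, 𝒮.c u (q i)) ∨ ∀ q', ¬ 𝒮.LocalMove ε₀ i q q' := by
  -- The invariant concerns inactive robots at the current configuration. It survives a change of
  -- configuration because only the robot that has just finished is then inactive.
  have key : ∀ s : 𝒮.State m, Relation.ReflTransGen (𝒮.Turn ε₀) (q₀, Finset.univ) s →
      ∀ i ∉ s.2, (¬ 0 < ∑ u ∈ 𝒮.part s.1 i, 𝒮.c u (s.1 i)) ∨
        ∀ q', ¬ 𝒮.LocalMove ε₀ i s.1 q' := by
    intro s hs
    induction hs with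
    | refl => exact fun i hi => absurd (Finset.mem_univ i) hi
    | tail _ hturn ih =>
      intro j hj
      cases hturn with
      | skip q A i hi guard =>
        by_cases hji : j = i
        · subst hji; exact Or.inl guard
        · exact ih j fun h => hj (Finset.mem_erase.2 ⟨hji, h⟩)
      | noMove q A i hi guard done =>
        by_cases hji : j = i
        · subst hji; exact Or.inr done
        · exact ih j fun h => hj (Finset.mem_erase.2 ⟨hji, h⟩)
      | moves q q' A i hi guard run done =>
        have hji : j = i := by
          by_contra h
          exact hj (Finset.mem_erase.2 ⟨h, Finset.mem_univ _⟩)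
        subst hji
        exact Or.inr done
  exact key _ hret i (Finset.notMem_empty i)

/-- In a returned configuration, moving any robot to any vertex gains less than the threshold. -/
theorem total_update_ge_of_returns {B : ℝ≥0} (hB : ∀ p ∈ P.X, ∀ q ∈ P.X, P.dist p q ≤ B)
    {q₀ q : 𝒮.Config m} (hret : 𝒮.Returns ε₀ q₀ q) (k : Fin m) (v : 𝒮.V) :
    𝒮.total q - ε₀ ≤ 𝒮.total (Function.update q k v) := by
  obtain ⟨own, hown⟩ := 𝒮.exists_owner k.pos q
  set i := own v
  have hv : v ∈ 𝒮.part q i := (hown v i).2 rfl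
  rcases inactive_of_returns hret i with guard | hno
  -- If robot `i` skips its turn, then `v` is at cost zero from `q i`, and by the triangle
  -- inequality a robot at `v` serves no vertex better than `i` does.
  · have hzero : 𝒮.c v (q i) ≤ 0 :=
      (Finset.single_le_sum (f := fun u => 𝒮.c u (q i)) (fun u _ => 𝒮.c_nonneg u (q i)) hv).trans
        (not_lt.1 guard)
    have hle : 𝒮.total q ≤ 𝒮.total (Function.update q k v) := by
      refine Finset.sum_le_sum fun u _ => mul_le_mul_of_nonneg_left ?_ (𝒮.w_nonneg u)
      refine 𝒮.le_minCost ⟨v, 𝒮.mem_range_update.2 (Or.inl rfl)⟩ fun x hx => ?_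
      rcases 𝒮.mem_range_update.1 hx with rfl | ⟨j, -, rfl⟩
      · exact (𝒮.minCost_le (mem_range_self i)).trans (by linarith [𝒮.c_triangle u x (q i)])
      · exact 𝒮.minCost_le (mem_range_self j)
    linarith [NNReal.coe_nonneg ε₀]
  · by_cases hk : k = i
    · have := delta_gt_of_forall_not_localMove hno hv
      rw [delta_eq hB hv] at this
      rw [hk]
      linarith
    · obtain ⟨h, hr⟩ := exists_reached (ε₀ := ε₀) (q := q) (i := i) hB (fun h k hh hr hacc => by
        obtain ⟨x, hx, hle⟩ := hacc
        exact absurd hle (not_le.2 (value_gt_of_forall_not_localMove hno hx hh hr))) k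
      have hh : 1 ≤ h := by
        rcases Nat.eq_zero_or_pos h with rfl | h0
        · exact absurd (reached_zero.1 hr) hk
        · exact h0
      have := value_gt_of_forall_not_localMove hno hv hh hr
      rw [value_eq hB hv hh hr] at this
      linarith

end Run

end Problem.Sampling

end Coverage

/-! ### Local optima are within a factor five -/

namespace Coverage

open Set

/-- For a map `η` of a finite type to itself there is an assignment `σ` that uses every value at most
twice, such that `o` is the only element which `η` can send to `σ o`. -/
theorem exists_swap_pairing {ι : Type*} [Fintype ι] [DecidableEq ι] (η : ι → ι) :
    ∃ σ : ι → ι, (∀ o o', η o' = σ o → o' = o) ∧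
      ∀ s, (Finset.univ.filter fun o => σ o = s).card ≤ 2 := by
  classical
  -- Elements alone in their fibre get `σ o = η o`. The others share fibres of size at least two, so
  -- the values missed by `η` number at least half of them, and each missed value can be used twice;
  -- `Bool` marks the two uses.
  set bad : Finset ι := Finset.univ.filter fun o => ∃ o', o' ≠ o ∧ η o' = η o
  set free : Finset ι := (Finset.univ.image η)ᶜ
  have hfib : ∀ s ∈ bad.image η, 2 ≤ (bad.filter fun o => η o = s).card := by
    intro s hs
    obtain ⟨o, ho, rfl⟩ := Finset.mem_image.1 hs
    obtain ⟨o', hne, heq⟩ := (Finset.mem_filter.1 ho).2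
    have ho' : o' ∈ bad := Finset.mem_filter.2 ⟨Finset.mem_univ _, o, hne.symm, heq.symm⟩
    exact Finset.one_lt_card.2 ⟨o', by simp [ho', heq], o, by simp [ho], hne⟩
  have h1 : 2 * (bad.image η).card ≤ bad.card := by
    rw [Finset.card_eq_sum_card_image η bad, mul_comm, ← smul_eq_mul]
    exact Finset.card_nsmul_le_sum _ _ _ hfib
  have h2 : (Finset.univ.image η).card ≤ (bad.image η).card + badᶜ.card := by
    rw [← Finset.union_compl bad, Finset.image_union]
    exact (Finset.card_union_le _ _).trans (Nat.add_le_add_left Finset.card_image_le _)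
  have h3 := Finset.card_add_card_compl bad
  have h4 : (Finset.univ.image η).card + free.card = Fintype.card ι :=
    Finset.card_add_card_compl _
  have hcard : Fintype.card bad ≤ Fintype.card (free × Bool) := by
    simp only [Fintype.card_coe, Fintype.card_prod, Fintype.card_bool]
    omega
  obtain ⟨e⟩ := Function.Embedding.nonempty_of_card_le hcard
  set σ : ι → ι := fun o => if h : o ∈ bad then (e ⟨o, h⟩).1 else η o with hσ
  have hgood : ∀ o, o ∉ bad → ∀ o', η o' = η o → o' = o := by
    intro o ho o' heq
    by_contra hne
    exact ho (Finset.mem_filter.2 ⟨Finset.mem_univ _, o', hne, heq⟩)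
  have hnot : ∀ x : free, ∀ o, η o ≠ x := by
    intro x o heq
    exact Finset.mem_compl.1 x.2 (Finset.mem_image.2 ⟨o, Finset.mem_univ _, heq⟩)
  refine ⟨σ, fun o o' heq => ?_, fun s => ?_⟩
  · by_cases ho : o ∈ bad
    · simp only [hσ, dif_pos ho] at heq
      exact absurd heq (hnot _ _)
    · simp only [hσ, dif_neg ho] at heq
      exact hgood o ho o' heq
  · rw [← Fintype.card_bool]
    refine Finset.card_le_card_of_injOn (t := (Finset.univ : Finset Bool))
      (fun o => if h : o ∈ bad then (e ⟨o, h⟩).2 else true) (fun _ _ => Finset.mem_univ _) ?_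
    intro a ha b hb hab
    have ha' : σ a = s := (Finset.mem_filter.1 ha).2
    have hb' : σ b = s := (Finset.mem_filter.1 hb).2
    have hσab : σ a = σ b := ha'.trans hb'.symm
    by_cases h : a ∈ bad <;> by_cases h' : b ∈ bad <;>
      simp only [hσ, h, h', dif_pos, dif_neg, not_false_eq_true] at hσab hab
    · have : e ⟨a, h⟩ = e ⟨b, h'⟩ := Prod.ext (Subtype.ext hσab) hab
      exact congrArg Subtype.val (e.injective this)
    · exact absurd hσab.symm (hnot _ _)
    · exact absurd hσab (hnot _ _)
    · exact hgood b h' a hσab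

namespace Problem.Sampling

variable {n : ℕ} {P : Problem n} {𝒮 : P.Sampling} {m : ℕ}

/-- A configuration that cannot be improved by more than `ε` by moving one robot has at most five
times the cost of any other configuration, up to `m ε`. -/
theorem total_le_five_mul (hm : 0 < m) {q : 𝒮.Config m} {ε : ℝ}
    (hloc : ∀ k v, 𝒮.total q - ε ≤ 𝒮.total (Function.update q k v)) (O : 𝒮.Config m) :
    𝒮.total q ≤ 5 * 𝒮.total O + m * ε := by
  classical
  have : Nonempty (Fin m) := ⟨⟨0, hm⟩⟩
  obtain ⟨oq, hoq⟩ := 𝒮.exists_owner hm q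
  obtain ⟨oO, hoO⟩ := 𝒮.exists_owner hm O
  choose η hη using fun o => Finite.exists_min fun j => 𝒮.c (O o) (q j)
  obtain ⟨σ, hσ, hcard⟩ := exists_swap_pairing η
  set S : 𝒮.V → ℝ := fun u => 𝒮.c u (q (oq u)) with hS
  set T : 𝒮.V → ℝ := fun u => 𝒮.c u (O (oO u)) with hT
  have hT0 : ∀ u, 0 ≤ T u := fun u => 𝒮.c_nonneg _ _
  have hSmin : ∀ u, 𝒮.minCost u (range q) = S u := fun u =>
    𝒮.minCost_range_of_mem_part ((hoq u _).2 rfl)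
  have hTmin : ∀ u, 𝒮.minCost u (range O) = T u := fun u =>
    𝒮.minCost_range_of_mem_part ((hoO u _).2 rfl)
  -- Robot `σ o` moves to `O o`. Vertices that `O` serves from `o` follow it. Any other vertex that
  -- loses its robot passes to the robot nearest to its server in `O`; that robot was not moved, by
  -- the choice of `σ`, and two triangle inequalities bound the new cost by `2 T u + S u`.
  have hswap : ∀ o u, 𝒮.minCost u (range (Function.update q (σ o) (O o))) - S u ≤
      (if oO u = o then T u - S u else 0) + (if σ o = oq u then 2 * T u else 0) := by
    intro o u
    by_cases h1 : oO u = o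
    · have : 𝒮.minCost u (range (Function.update q (σ o) (O o))) ≤ T u :=
        𝒮.minCost_le (𝒮.mem_range_update.2 (Or.inl (by rw [h1])))
      rw [if_pos h1]
      split_ifs <;> linarith [hT0 u]
    · rw [if_neg h1]
      by_cases h2 : σ o = oq u
      · rw [if_pos h2]
        have hne : η (oO u) ≠ σ o := fun h => h1 (hσ o _ h)
        have a1 : 𝒮.minCost u (range (Function.update q (σ o) (O o))) ≤
            𝒮.c u (q (η (oO u))) :=
          𝒮.minCost_le (𝒮.mem_range_update.2 (Or.inr ⟨_, hne, rfl⟩))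
        have a2 := 𝒮.c_triangle u (O (oO u)) (q (η (oO u)))
        have a3 := hη (oO u) (oq u)
        have a4 := 𝒮.c_triangle (O (oO u)) u (q (oq u))
        rw [𝒮.c_comm (O (oO u)) u] at a4
        simp only [hS, hT]
        linarith
      · rw [if_neg h2]
        have a1 : 𝒮.minCost u (range (Function.update q (σ o) (O o))) ≤ 𝒮.c u (q (oq u)) :=
          𝒮.minCost_le (𝒮.mem_range_update.2 (Or.inr ⟨_, Ne.symm h2, rfl⟩))
        simp only [hS]
        linarith
  have hsum : ∀ u, ∑ o, (𝒮.minCost u (range (Function.update q (σ o) (O o))) - S u) ≤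
      5 * T u - S u := by
    intro u
    refine (Finset.sum_le_sum fun o _ => hswap o u).trans ?_
    rw [Finset.sum_add_distrib, Finset.sum_ite_eq, if_pos (Finset.mem_univ _), ← Finset.sum_filter,
      Finset.sum_const, nsmul_eq_mul]
    -- The robot of `u` is swapped out at most twice, at a price of `2 T u` each; with the single
    -- gain `T u - S u` this gives `5 T u - S u`.
    have : ((Finset.univ.filter fun o => σ o = oq u).card : ℝ) ≤ 2 := by exact_mod_cast hcard _
    nlinarith [hT0 u]
  have htotal : ∑ o, (𝒮.total (Function.update q (σ o) (O o)) - 𝒮.total q) ≤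
      5 * 𝒮.total O - 𝒮.total q := by
    simp only [total, hSmin, hTmin, ← Finset.sum_sub_distrib, Finset.mul_sum]
    rw [Finset.sum_comm]
    refine Finset.sum_le_sum fun u _ => ?_
    have := mul_le_mul_of_nonneg_left (hsum u) (𝒮.w_nonneg u)
    rw [Finset.mul_sum] at this
    simp only [mul_sub] at this ⊢
    linarith
  have hlow : ∑ _o : Fin m, (-ε) ≤
      ∑ o, (𝒮.total (Function.update q (σ o) (O o)) - 𝒮.total q) :=
    Finset.sum_le_sum fun o _ => by linarith [hloc (σ o) (O o)]
  rw [Finset.sum_const, Finset.card_univ, Fintype.card_fin, nsmul_eq_mul] at hlow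
  linarith

end Problem.Sampling

end Coverage

/-! ### Comparison of the discrete and the continuous cost -/

namespace Coverage

open Set MeasureTheory

namespace Problem.Sampling

variable {n : ℕ} {P : Problem n} {𝒮 : P.Sampling} {m : ℕ}

theorem ofReal_w (v : 𝒮.V) : ENNReal.ofReal (𝒮.w v) =
    ∫⁻ p in {p | p ∈ P.X ∧ 𝒮.near p = v}, (P.φ p : ℝ≥0∞) := by
  refine ENNReal.ofReal_toReal (ne_top_of_le_ne_top ENNReal.one_ne_top ?_)
  rw [← P.mass_one]
  exact lintegral_mono_set fun p hp => hp.1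

/-- The integral of a function of the closest sample. -/
theorem lintegral_near (g : 𝒮.V → ℝ≥0∞) (hg : ∀ v, g v ≠ ∞) :
    ∫⁻ p in P.X, g (𝒮.near p) * (P.φ p : ℝ≥0∞) = ∑ v, g v * ENNReal.ofReal (𝒮.w v) := by
  have hX : (⋃ v, {p | p ∈ P.X ∧ 𝒮.near p = v}) = P.X := by
    ext p
    simp
  have hdisj : Pairwise (Function.onFun Disjoint fun v => {p | p ∈ P.X ∧ 𝒮.near p = v}) :=
    fun v v' hne => Set.disjoint_left.2 fun p hp hp' => hne (hp.2.symm.trans hp'.2)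
  calc ∫⁻ p in P.X, g (𝒮.near p) * (P.φ p : ℝ≥0∞)
      = ∫⁻ p in ⋃ v, {p | p ∈ P.X ∧ 𝒮.near p = v}, g (𝒮.near p) * (P.φ p : ℝ≥0∞) := by rw [hX]
    _ = ∑ v, ∫⁻ p in {p | p ∈ P.X ∧ 𝒮.near p = v}, g (𝒮.near p) * (P.φ p : ℝ≥0∞) := by
        rw [lintegral_iUnion 𝒮.measurableSet_cell hdisj, tsum_fintype]
    _ = ∑ v, g v * ENNReal.ofReal (𝒮.w v) := by
        refine Finset.sum_congr rfl fun v _ => ?_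
        rw [ofReal_w, ← lintegral_const_mul' _ _ (hg v)]
        exact setLIntegral_congr_fun (𝒮.measurableSet_cell v) fun p hp => by
          simp only [hp.2]

theorem sum_ofReal_w : ∑ v, ENNReal.ofReal (𝒮.w v) = 1 := by
  have := lintegral_near (𝒮 := 𝒮) (fun _ => 1) fun _ => ENNReal.one_ne_top
  simpa [P.mass_one] using this.symm

theorem minCost_nonneg (u : 𝒮.V) (T : Set 𝒮.V) : 0 ≤ 𝒮.minCost u T :=
  Real.sInf_nonneg (by rintro _ ⟨x, -, rfl⟩; exact 𝒮.c_nonneg u x)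

theorem ofReal_total (q : 𝒮.Config m) : ENNReal.ofReal (𝒮.total q) =
    ∑ v, ENNReal.ofReal (𝒮.minCost v (range q)) * ENNReal.ofReal (𝒮.w v) := by
  rw [total, ENNReal.ofReal_sum_of_nonneg
    fun v _ => mul_nonneg (𝒮.w_nonneg v) (𝒮.minCost_nonneg v _)]
  exact Finset.sum_congr rfl fun v _ => by rw [ENNReal.ofReal_mul (𝒮.w_nonneg v), mul_comm]

theorem ofReal_c (u v : 𝒮.V) : ENNReal.ofReal (𝒮.c u v) = P.f (P.dist u v) :=
  ENNReal.ofReal_coe_nnreal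

/-- Every location can go through its closest sample, a detour of at most `ζ`; `φ` has mass one. -/
theorem cost_loc_le (hm : 0 < m) {ζ : ℝ≥0} (hζ : 𝒮.IsDispersion ζ) (q : 𝒮.Config m) :
    P.cost (𝒮.loc q) ≤ ENNReal.ofReal (𝒮.total q) + P.f ζ := by
  obtain ⟨own, hown⟩ := 𝒮.exists_owner hm q
  calc P.cost (𝒮.loc q)
      ≤ ∫⁻ p in P.X, (ENNReal.ofReal (𝒮.minCost (𝒮.near p) (range q)) + P.f ζ) *
          (P.φ p : ℝ≥0∞) := by
        refine setLIntegral_mono' P.isCompact_X.measurableSet fun p hp => ?_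
        gcongr
        refine (iInf_le _ (own (𝒮.near p))).trans ?_
        rw [𝒮.minCost_range_of_mem_part ((hown _ _).2 rfl), ofReal_c, ← ENNReal.coe_add,
          ENNReal.coe_le_coe, add_comm]
        refine (P.strictMono_f.monotone ((P.dist_triangle hp (𝒮.mem_X (𝒮.near p))
          (𝒮.loc_mem_X q _)).trans (add_le_add_left (𝒮.dist_near_le_dispersion hζ hp) _))).trans ?_
        exact P.subadditive_f _ _
    _ = ENNReal.ofReal (𝒮.total q) + P.f ζ := by
        rw [lintegral_near (fun v => ENNReal.ofReal (𝒮.minCost v (range q)) + P.f ζ)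
          (fun v => by simp), ofReal_total]
        simp only [add_mul, Finset.sum_add_distrib]
        rw [← Finset.mul_sum, sum_ofReal_w, mul_one]

/-- Two roundings, of the location and of the robot, cost at most `f ζ` each. -/
theorem ofReal_total_near_le {ζ : ℝ≥0} (hζ : 𝒮.IsDispersion ζ) {Q : Fin m → Loc n}
    (hQ : ∀ i, Q i ∈ P.X) :
    ENNReal.ofReal (𝒮.total fun i => 𝒮.near (Q i)) ≤ P.cost Q + 2 * P.f ζ := by
  calc ENNReal.ofReal (𝒮.total fun i => 𝒮.near (Q i))
      = ∫⁻ p in P.X, ENNReal.ofReal (𝒮.minCost (𝒮.near p) (range fun i => 𝒮.near (Q i))) *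
          (P.φ p : ℝ≥0∞) := by
        rw [ofReal_total, lintegral_near (fun v => ENNReal.ofReal (𝒮.minCost v
          (range fun i => 𝒮.near (Q i)))) (fun v => ENNReal.ofReal_ne_top)]
    _ ≤ ∫⁻ p in P.X, ((⨅ i, (P.f (P.dist p (Q i)) : ℝ≥0∞)) * (P.φ p : ℝ≥0∞) +
          2 * P.f ζ * (P.φ p : ℝ≥0∞)) := by
        refine setLIntegral_mono' P.isCompact_X.measurableSet fun p hp => ?_
        rw [← add_mul, ENNReal.iInf_add]
        gcongr
        refine le_iInf fun i => ?_
        refine (ENNReal.ofReal_le_ofReal (𝒮.minCost_le (mem_range_self i))).trans ?_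
        rw [ofReal_c]
        have h1 := P.dist_triangle (𝒮.mem_X (𝒮.near p)) hp (𝒮.mem_X (𝒮.near (Q i)))
        have h2 := P.dist_triangle hp (hQ i) (𝒮.mem_X (𝒮.near (Q i)))
        have h3 := 𝒮.dist_near_le_dispersion hζ hp
        have h4 := 𝒮.dist_near_le_dispersion hζ (hQ i)
        rw [P.dist_comm] at h3
        have h5 := P.strictMono_f.monotone
          (h1.trans (add_le_add h3 (h2.trans (add_le_add_right h4 _))))
        have h6 := h5.trans ((P.subadditive_f _ _).trans
          (add_le_add_right (P.subadditive_f _ _) _))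
        have h7 : P.f (P.dist (𝒮.near p) (𝒮.near (Q i))) ≤ P.f (P.dist p (Q i)) + 2 * P.f ζ :=
          h6.trans (le_of_eq (by ring))
        exact_mod_cast h7
    _ = P.cost Q + 2 * P.f ζ := by
        -- Additivity is taken from the measurability of the second summand, so none is needed for
        -- the distance to the robots.
        rw [lintegral_add_right' _ (P.aemeasurable_φ.coe_nnreal_ennreal.const_mul _),
          lintegral_const_mul' _ _ (by finiteness), P.mass_one, mul_one]
        rfl

end Problem.Sampling

end Coverage

theorem mainTheorem3 {n m : ℕ} (hm : 0 < m) (P : Coverage.Problem n) (𝒮 : P.Sampling)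
    (ζ : NNReal) (hζ : 𝒮.IsDispersion ζ) (ε₀ : NNReal) (hε₀ : 0 < ε₀) (q₀ : 𝒮.Config m) :
    (∃ q, 𝒮.Returns ε₀ q₀ q) ∧
    ∀ q, 𝒮.Returns ε₀ q₀ q → ∀ Sstar : Fin m → Coverage.Loc n, P.IsOptimal Sstar →
      P.cost (𝒮.loc q) ≤ 5 * P.cost Sstar + ((21 * P.f ζ + m * ε₀ : NNReal) : ENNReal) := by
  obtain ⟨B, hB⟩ := 𝒮.exists_dist_le hζ
  refine ⟨Coverage.Problem.Sampling.exists_turns hB hε₀ q₀ Finset.univ, ?_⟩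
  intro q hret Sstar hopt
  have h1 := Coverage.Problem.Sampling.total_le_five_mul hm
    (Coverage.Problem.Sampling.total_update_ge_of_returns hB hret) fun i => 𝒮.near (Sstar i)
  have h2 := Coverage.Problem.Sampling.cost_loc_le hm hζ q
  have h3 := Coverage.Problem.Sampling.ofReal_total_near_le hζ hopt.1
  have h4 : ENNReal.ofReal (𝒮.total q) ≤
      5 * ENNReal.ofReal (𝒮.total fun i => 𝒮.near (Sstar i)) + m * ε₀ := by
    refine (ENNReal.ofReal_le_ofReal h1).trans (ENNReal.ofReal_add_le.trans (le_of_eq ?_))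
    rw [ENNReal.ofReal_mul (by norm_num), ENNReal.ofReal_mul (Nat.cast_nonneg m)]
    simp
  calc P.cost (𝒮.loc q)
      ≤ 5 * (P.cost Sstar + 2 * P.f ζ) + m * ε₀ + P.f ζ := by
        refine h2.trans (add_le_add (h4.trans ?_) le_rfl)
        gcongr
    -- Here `11 = 5 · 2 + 1`: the rounding of `Sstar` is multiplied by five, and the return to the
    -- continuous cost adds one.
    _ = 5 * P.cost Sstar + ((11 * P.f ζ + m * ε₀ : NNReal) : ENNReal) := by
        push_cast
        ring
    _ ≤ 5 * P.cost Sstar + ((21 * P.f ζ + m * ε₀ : NNReal) : ENNReal) := by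
        gcongr
        norm_num
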